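/- **Setting.** Simple types are $\sigma,\tau ::= o \mid \sigma\to\tau$. Fix a ranked alphabet $\Sigma$ and an alternating parity tree automaton $\mathcal A$ over $\Sigma$ with finite set of states $Q$, transition function $\delta$ (each $\delta(q,a)$, for $a\in\Sigma$ of arity $n$, is a finite disjunction of conjunctive clauses, i.e. of finite sets of pairs in $\{1,\dots,n\}\times Q$) and colouring $\Omega:Q\to\mathbb N$. Let $Col=\Omega(Q)\uplus\{\epsilon\}$, where $\epsilon$ is a new least element, neutral for $\max$. The simply typed $\lambda Y$-terms are generated by variables, constants $a\in\Sigma$ of arity $n$ (of type $o\to\cdots\to o\to o$ with $n$ arguments), abstraction, application, and $Y_\sigma M::\sigma$ for $M::\sigma\to\sigma$. An infinite sequence of colours is *winning* if some element of $Col\setminus\{\epsilon\}$ occurs infinitely often in it and the greatest such element is even. A coloured tree is winning if all its infinite branches are. **The coloured Scott model.** $\mathbf{ScottL}$ is the category of preorders and downward-closed relations ($(a,b)\in R$, $a\le a'$, $b'\le b$ imply $(a',b')\in R$), with relational composition, $A\otimes B=A\times B$, $A\multimap B=A^{op}\times B$ and product $A\mathbin{\&}B=A\uplus B$. For a preorder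 $A$, let $\square A=Col\times A$ with $(c,a)\le(c',a')$ iff $c=c'$ and $a\le a'$; let $!A$ be the set of finite subsets of $A$, with $u\le v$ iff every element of $u$ is below an element of $v$; and let $\dagger A={!}\square A$. With counit $\{(u,a)\mid\exists(\epsilon,a')\in u,\ a\le a'\}$ and the comultiplication composed from $\{(u,U)\mid\forall w\in U,\ w\le u\}:{!}A\to{!!}A$, $\{((\max(c_1,c_2),a),(c_1,(c_2,a')))\mid a'\le a\}:\square A\to\square\square A$ and the distributive law $\{(w,(c,v))\mid\forall a\in v\ \exists(c,a')\in w,\ a\le a'\}:{!}\square A\to\square{!}A$, $\dagger$ is a comonad satisfying the Seely axioms; its Kleisli category is cartesian closed. Put $[\![o]\!]=(Q,=)$ and $[\![\sigma\to\tau]\!]=\dagger[\![\sigma]\!]\multimap[\![\tau]\!]$. A term $t::\tau$ in context $x_1::\sigma_1,\dots,x_n::\sigma_n$ is interpreted in this Kleisli category as a downward-closed relation $$[\![\Gamma\vdash t::\tau]\!]\subseteq(\dagger[\![\sigma_1]\!]\otimes\cdots\otimes\dagger[\![\sigma_n]\!])\multimap[\![\tau]\!],$$ where the variables, abstraction and application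 are interpreted by the cartesian closed structure, and the constants and $Y$ as follows. * A constant $a$ of arity $n$ is interpreted by the set of all $(\alpha_1,\dots,\alpha_n,q)$ such that $(\alpha_1,\dots,\alpha_n)$ *satisfies* $\delta(q,a)$: there are $J_k\subseteq\alpha_k$ such that $\{(k,q')\mid \exists c,\ (c,q')\in J_k\}$ is a conjunctive clause of $\delta(q,a)$ and $c=\Omega(q')$ for all $(c,q')\in J_k$. * $Y_\sigma M$ is interpreted by $\mathbf Y(R)$, where $R:\dagger X\otimes\dagger A\to A$ is the uncurried interpretation of $M$, $A=[\![\sigma]\!]$ and $X=[\![\sigma_1]\!]\mathbin{\&}\cdots\mathbin{\&}[\![\sigma_n]\!]$ (so that $\dagger X\cong\dagger[\![\sigma_1]\!]\otimes\cdots\otimes\dagger[\![\sigma_n]\!]$). Here $(u,a)\in\mathbf Y(R)$ iff there is a winning semantic run-tree of $R$ producing $a$ whose set of leaves is $u$. A *semantic run-tree* of $R$ producing $a$ is a finitely branching, possibly infinite $(X\uplus A)$-labelled tree with nodes coloured in $Col$, whose root has label $a$ and colour $\epsilon$, whose nodes labelled in $X$ are leaves, and such that $(w,v,b)\in R$ for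 each node labelled by $b\in A$, where $w$ and $v$ are the sets of pairs (colour, label) of its children labelled in $X$ and in $A$ respectively (both are empty if the node is a leaf). Its *set of leaves* consists of the pairs $(c,x)$ such that some leaf is labelled by $x\in X$ and $c$ is the greatest colour on the path from this leaf to the root, both included. **The type system.** Sequents are $\Gamma=x_1:u_1::\sigma_1,\dots,x_n:u_n::\sigma_n\vdash t:\alpha::\tau$ with $u_i\in\dagger[\![\sigma_i]\!]$ and $\alpha\in[\![\tau]\!]$. Write $u\to\alpha$ for $(u,\alpha)\in[\![\sigma\to\tau]\!]$; let $\square_c\Gamma$ replace each $(d,\beta)$ occurring in $\Gamma$ by $(\max(c,d),\beta)$, and let $\cup$ be the componentwise union of contexts. The rules are: * (Ax) $\Gamma\vdash x:\alpha$, if $x:u$ is in $\Gamma$ and there is $(\epsilon,\alpha')\in u$ with $\alpha\le\alpha'$; * ($\delta$) $\Gamma\vdash a:\alpha_1\to\cdots\to\alpha_n\to q$, if $(\alpha_1,\dots,\alpha_n)$ satisfies $\delta(q,a)$; * ($\lambda$) from $\Gamma,x:u\vdash M:\alpha$ infer $\Gamma\vdash\lambda x.M:u\to\alpha$; * (App)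 from $\Gamma_0\vdash M:\{(c_1,\beta_1),\dots,(c_m,\beta_m)\}\to\alpha$ and $\Gamma_i\vdash N:\beta_i$ for $1\le i\le m$ infer $\Gamma_0\cup\square_{c_1}\Gamma_1\cup\dots\cup\square_{c_m}\Gamma_m\vdash M\,N:\alpha$; * ($Y_\sigma$) from $\Gamma_0\vdash M:\{(c_1,\beta_1),\dots,(c_m,\beta_m)\}\to\alpha$ and $\Gamma_i\vdash Y_\sigma M:\beta_i$ for $1\le i\le m$ infer $\Gamma_0\cup\square_{c_1}\Gamma_1\cup\dots\cup\square_{c_m}\Gamma_m\vdash Y_\sigma M:\alpha$. Derivation trees may be infinite. In an instance of ($Y_\sigma$) the premise $\Gamma_i\vdash Y_\sigma M:\beta_i$ has colour $c_i$; all other nodes have colour $\epsilon$. **Theorem.** For every $\lambda Y$-term $t::\tau$ in context $x_1::\sigma_1,\dots,x_n::\sigma_n$, all $u_i\in\dagger[\![\sigma_i]\!]$ and all $\alpha\in[\![\tau]\!]$, the sequent $$x_1:u_1::\sigma_1,\dots,x_n:u_n::\sigma_n\vdash t:\alpha::\tau$$ has a winning derivation tree if and only if $$(u_1,\dots,u_n,\alpha)\in[\![\Gamma\vdash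 t::\tau]\!].$$ -/

import Mathlib

universe u v

namespace ColScott

/-! ### Simple types and the simply typed λY-calculus over a ranked alphabet -/

/-- Simple types `σ, τ ::= o | σ → τ`. -/
inductive Ty : Type
  | o : Ty
  | arr : Ty → Ty → Ty

/-- The type `o → ⋯ → o → o` with `n` arguments, i.e. the type of a constructor of arity `n`. -/
def Ty.ofArity : ℕ → Ty
  | 0 => .o
  | n + 1 => .arr .o (Ty.ofArity n)

/-- `Var Γ σ`: the variables of type `σ` declared in the context `Γ`. -/
inductive Var : List Ty → Ty → Type
  | zero {Γ : List Ty} {σ : Ty} : Var (σ :: Γ) σ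
  | succ {Γ : List Ty} {σ τ : Ty} : Var Γ σ → Var (τ :: Γ) σ

/-- Simply typed λY-terms in context, with constants in the ranked alphabet `(Sig, ar)`. -/
inductive Tm {Sig : Type v} (ar : Sig → ℕ) : List Ty → Ty → Type v
  | var {Γ : List Ty} {σ : Ty} : Var Γ σ → Tm ar Γ σ
  | con {Γ : List Ty} (a : Sig) : Tm ar Γ (Ty.ofArity (ar a))
  | lam {Γ : List Ty} {σ τ : Ty} : Tm ar (σ :: Γ) τ → Tm ar Γ (.arr σ τ)
  | app {Γ : List Ty} {σ τ : Ty} : Tm ar Γ (.arr σ τ) → Tm ar Γ σ → Tm ar Γ τ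
  | fix {Γ : List Ty} {σ : Ty} : Tm ar Γ (.arr σ σ) → Tm ar Γ σ

/-! ### Preorders and downward-closed relations -/

/-- Objects of the category `ScottL`: preorders. -/
structure Obj : Type (u + 1) where
  carrier : Type u
  le : carrier → carrier → Prop
  refl : ∀ a, le a a
  trans : ∀ {a b c}, le a b → le b c → le a c

/-- Morphisms of `ScottL`: downward-closed relations. -/
@[ext]
structure Mor (A B : Obj.{u}) where
  rel : A.carrier → B.carrier → Prop
  closed : ∀ {a a' b b'}, rel a b → A.le a a' → B.le b' b → rel a' b'

/-- Identity of `ScottL`. -/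
def Mor.id (A : Obj.{u}) : Mor A A where
  rel a' a := A.le a a'
  closed h h₁ h₂ := A.trans h₂ (A.trans h h₁)

/-- Relational composition, in diagrammatic order. -/
def Mor.comp {A B C : Obj.{u}} (R : Mor A B) (S : Mor B C) : Mor A C where
  rel a c := ∃ b, R.rel a b ∧ S.rel b c
  closed := by
    rintro a a' c c' ⟨b, h₁, h₂⟩ ha hc
    exact ⟨b, R.closed h₁ ha (B.refl b), S.closed h₂ (B.refl b) hc⟩

/-- The tensor product. -/
abbrev Obj.tensor (A B : Obj.{u}) : Obj.{u} where
  carrier := A.carrier × B.carrier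
  le p q := A.le p.1 q.1 ∧ B.le p.2 q.2
  refl _ := ⟨A.refl _, B.refl _⟩
  trans h h' := ⟨A.trans h.1 h'.1, B.trans h.2 h'.2⟩

def Mor.tensor {A B C D : Obj.{u}} (R : Mor A B) (S : Mor C D) :
    Mor (A.tensor C) (B.tensor D) where
  rel p q := R.rel p.1 q.1 ∧ S.rel p.2 q.2
  closed h h₁ h₂ := ⟨R.closed h.1 h₁.1 h₂.1, S.closed h.2 h₁.2 h₂.2⟩

/-- The linear arrow `A ⊸ B`, i.e. `Aᵒᵖ × B`. -/
abbrev Obj.lolli (A B : Obj.{u}) : Obj.{u} where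
  carrier := A.carrier × B.carrier
  le p q := A.le q.1 p.1 ∧ B.le p.2 q.2
  refl _ := ⟨A.refl _, B.refl _⟩
  trans h h' := ⟨A.trans h'.1 h.1, B.trans h.2 h'.2⟩

/-- Evaluation `(A ⊸ B) ⊗ A → B`. -/
def Mor.ev (A B : Obj.{u}) : Mor ((A.lolli B).tensor A) B where
  rel p b := A.le p.1.1 p.2 ∧ B.le b p.1.2
  closed h h₁ h₂ := ⟨A.trans h₁.1.1 (A.trans h.1 h₁.2), B.trans h₂ (B.trans h.2 h₁.1.2)⟩

/-- Linear currying. -/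
def Mor.curry {A B C : Obj.{u}} (R : Mor (A.tensor B) C) : Mor A (B.lolli C) where
  rel a p := R.rel (a, p.1) p.2
  closed h h₁ h₂ := R.closed h ⟨h₁, h₂.1⟩ h₂.2

/-- Linear uncurrying. -/
def Mor.uncurry {A B C : Obj.{u}} (R : Mor A (B.lolli C)) : Mor (A.tensor B) C where
  rel p c := R.rel p.1 (p.2, c)
  closed h h₁ h₂ := R.closed h h₁.1 ⟨h₁.2, h₂⟩

/-- The cartesian product `A & B`: disjoint union of preorders. -/
abbrev Obj.prod (A B : Obj.{u}) : Obj.{u} where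
  carrier := A.carrier ⊕ B.carrier
  le := Sum.LiftRel A.le B.le
  refl
    | .inl a => .inl (A.refl a)
    | .inr b => .inr (B.refl b)
  trans
    | .inl h, .inl h' => .inl (A.trans h h')
    | .inr h, .inr h' => .inr (B.trans h h')

/-- The terminal object `⊤`: the empty preorder. -/
abbrev Obj.top : Obj.{u} where
  carrier := PEmpty
  le _ _ := True
  refl _ := trivial
  trans _ _ := trivial

/-! ### The exponential `!` -/

/-- `!A`: finite subsets, `u ≤ v` iff every element of `u` is below some element of `v`. -/
abbrev Obj.bang (A : Obj.{u}) : Obj.{u} where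
  carrier := Finset A.carrier
  le u v := ∀ a ∈ u, ∃ b ∈ v, A.le a b
  refl u a ha := ⟨a, ha, A.refl a⟩
  trans h h' a ha := by
    obtain ⟨b, hb, hab⟩ := h a ha
    obtain ⟨c, hc, hbc⟩ := h' b hb
    exact ⟨c, hc, A.trans hab hbc⟩

/-- Functorial action of `!`. -/
def Mor.bang {A B : Obj.{u}} (R : Mor A B) : Mor A.bang B.bang where
  rel u v := ∀ b ∈ v, ∃ a ∈ u, R.rel a b
  closed := by
    intro u u' v v' h hu hv b hb
    obtain ⟨b₁, hb₁, hle⟩ := hv b hb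
    obtain ⟨a, ha, hR⟩ := h b₁ hb₁
    obtain ⟨a', ha', hle'⟩ := hu a ha
    exact ⟨a', ha', R.closed hR hle' hle⟩

/-- Counit of `!`. -/
def Mor.bangDer (A : Obj.{u}) : Mor A.bang A where
  rel u a := ∃ a' ∈ u, A.le a a'
  closed := by
    rintro u u' a b ⟨a', ha', h⟩ hu hb
    obtain ⟨a'', ha'', h'⟩ := hu a' ha'
    exact ⟨a'', ha'', A.trans hb (A.trans h h')⟩

/-- Comultiplication of `!`. -/
def Mor.bangDig (A : Obj.{u}) : Mor A.bang A.bang.bang where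
  rel u U := ∀ w ∈ U, A.bang.le w u
  closed := by
    intro u u' U U' h hu hU w hw
    obtain ⟨w', hw', hle⟩ := hU w hw
    exact A.bang.trans hle (A.bang.trans (h w' hw') hu)

/-! ### The colouring comonad `□` and the coloured exponential `!□`

The colours range over a linear order `C` whose least element `⊥` is the neutral colour `ε`. -/

section Colour

variable (C : Type) [LinearOrder C] [OrderBot C]

/-- `□A`: the `C`-fold product `A & ⋯ & A`. -/
abbrev Obj.box (A : Obj.{u}) : Obj.{u} where
  carrier := C × A.carrier
  le p q := p.1 = q.1 ∧ A.le p.2 q.2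
  refl _ := ⟨rfl, A.refl _⟩
  trans h h' := ⟨h.1.trans h'.1, A.trans h.2 h'.2⟩

/-- Functorial action of `□`. -/
def Mor.box {A B : Obj.{u}} (R : Mor A B) : Mor (A.box C) (B.box C) where
  rel p q := p.1 = q.1 ∧ R.rel p.2 q.2
  closed h h₁ h₂ := ⟨h₁.1.symm.trans (h.1.trans h₂.1.symm), R.closed h.2 h₁.2 h₂.2⟩

/-- Counit of `□`. -/
def Mor.boxDer (A : Obj.{u}) : Mor (A.box C) A where
  rel p a := p.1 = ⊥ ∧ A.le a p.2
  closed h h₁ h₂ := ⟨h₁.1.symm.trans h.1, A.trans h₂ (A.trans h.2 h₁.2)⟩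

/-- Comultiplication of `□`. -/
def Mor.boxDig (A : Obj.{u}) : Mor (A.box C) ((A.box C).box C) where
  rel p q := p.1 = max q.1 q.2.1 ∧ A.le q.2.2 p.2
  closed := by
    rintro a a' b b' ⟨h, h'⟩ ⟨h₁, h₁'⟩ ⟨h₂, h₂', h₂''⟩
    exact ⟨by rw [← h₁, h, h₂, h₂'], A.trans h₂'' (A.trans h' h₁')⟩

/-- The distributive law `!□ ⇒ □!`. -/
def Mor.dist (A : Obj.{u}) : Mor (A.box C).bang (A.bang.box C) where
  rel w p := ∀ a ∈ p.2, ∃ e ∈ w, p.1 = e.1 ∧ A.le a e.2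
  closed := by
    rintro w w' p p' h hw ⟨hc, hp⟩ a ha
    obtain ⟨a₁, ha₁, hle₁⟩ := hp a ha
    obtain ⟨e, he, hce, hle⟩ := h a₁ ha₁
    obtain ⟨e', he', hce', hle'⟩ := hw e he
    exact ⟨e', he', hc.trans (hce.trans hce'), A.trans hle₁ (A.trans hle hle')⟩

/-- The coloured exponential `!□A`. -/
abbrev Obj.cbang (A : Obj.{u}) : Obj.{u} := (A.box C).bang

/-- Functorial action of the coloured exponential. -/
def Mor.cbang {A B : Obj.{u}} (R : Mor A B) : Mor (A.cbang C) (B.cbang C) := (R.box C).bang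

/-- Counit of the coloured exponential. -/
def Mor.der (A : Obj.{u}) : Mor (A.cbang C) A := (Mor.bangDer (A.box C)).comp (Mor.boxDer C A)

/-- Comultiplication `!□ → !!□ → !!□□ → !□!□` of the coloured exponential. -/
def Mor.dig (A : Obj.{u}) : Mor (A.cbang C) ((A.cbang C).cbang C) :=
  ((Mor.bangDig (A.box C)).comp (Mor.boxDig C A).bang.bang).comp (Mor.dist C (A.box C)).bang

/-- Contraction `!□A → !□A ⊗ !□A`. -/
def Mor.contr (A : Obj.{u}) : Mor (A.cbang C) ((A.cbang C).tensor (A.cbang C)) where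
  rel w p := (A.cbang C).le p.1 w ∧ (A.cbang C).le p.2 w
  closed h h₁ h₂ :=
    ⟨Obj.trans _ h₂.1 (Obj.trans _ h.1 h₁), Obj.trans _ h₂.2 (Obj.trans _ h.2 h₁)⟩

/-- The Seely isomorphism `!□A ⊗ !□B → !□(A & B)`. -/
def Mor.seely (A B : Obj.{u}) : Mor ((A.cbang C).tensor (B.cbang C)) ((A.prod B).cbang C) where
  rel p w :=
    (∀ c a, (c, Sum.inl a) ∈ w → ∃ a', (c, a') ∈ p.1 ∧ A.le a a') ∧
    (∀ c b, (c, Sum.inr b) ∈ w → ∃ b', (c, b') ∈ p.2 ∧ B.le b b')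
  closed := by
    rintro p p' w w' ⟨hA, hB⟩ ⟨h₁, h₂⟩ hw
    constructor
    · intro c a ha
      obtain ⟨⟨c₁, e⟩, he, hc, hle⟩ := hw _ ha
      obtain rfl : c = c₁ := hc
      cases hle with
      | inl hle =>
        obtain ⟨a₂, ha₂, hle₂⟩ := hA _ _ he
        obtain ⟨⟨c₃, a₃⟩, ha₃, hc₃, hle₃⟩ := h₁ _ ha₂
        obtain rfl : c = c₃ := hc₃
        exact ⟨a₃, ha₃, A.trans hle (A.trans hle₂ hle₃)⟩
    · intro c b hb
      obtain ⟨⟨c₁, e⟩, he, hc, hle⟩ := hw _ hb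
      obtain rfl : c = c₁ := hc
      cases hle with
      | inr hle =>
        obtain ⟨a₂, ha₂, hle₂⟩ := hB _ _ he
        obtain ⟨⟨c₃, a₃⟩, ha₃, hc₃, hle₃⟩ := h₂ _ ha₂
        obtain rfl : c = c₃ := hc₃
        exact ⟨a₃, ha₃, B.trans hle (B.trans hle₂ hle₃)⟩

end Colour

/-! ### Coloured trees

A (finitely branching, possibly infinite) coloured tree is given by its nodes: `t p` is the colour
and label of the node at address `p` (the list of child indices read from the root), and `none` if
there is no such node. -/

section Trees

variable {C : Type} [LinearOrder C] [OrderBot C]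

/-- The tree `t` has a root, and for every node, the list of its coloured children is allowed by
`step` below the label of that node. -/
structure IsTree {L : Type u} (step : L → List (C × L) → Prop) (root : C × L)
    (t : List ℕ → Option (C × L)) : Prop where
  root_eq : t [] = some root
  children : ∀ p c x, t p = some (c, x) →
    ∃ cs : List (C × L), step x cs ∧ ∀ k, t (p ++ [k]) = cs[k]?
  none_of_none : ∀ p k, t p = none → t (p ++ [k]) = none

/-- Colour of the node at address `p` (junk value `⊥` if there is no such node). -/
def colourAt {L : Type u} (t : List ℕ → Option (C × L)) (p : List ℕ) : C :=
  (t p).elim ⊥ Prod.fst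

/-- Maximal colour on the path from the root to the node at address `p`, both included. -/
def pathColour {L : Type u} (t : List ℕ → Option (C × L)) (p : List ℕ) : C :=
  (Finset.range (p.length + 1)).sup fun i => colourAt t (p.take i)

/-- The address of the `n`-th node on the branch which follows the child indices `f`. -/
def prefixAt (f : ℕ → ℕ) (n : ℕ) : List ℕ := (List.range n).map f

/-- A tree is winning if all its infinite branches have a winning sequence of colours. -/
def TreeWins {L : Type u} (win : (ℕ → C) → Prop) (t : List ℕ → Option (C × L)) : Prop :=
  ∀ f : ℕ → ℕ, (∀ n, t (prefixAt f n) ≠ none) → win fun n => colourAt t (prefixAt f n)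

/-- Local condition on semantic run-trees of `R : !□X ⊗ !□A → A`: a node labelled in `X` is a leaf,
and at a node labelled `b ∈ A`, the sets of coloured labels of the children in `X` and in `A`
are related to `b` by `R` (for a leaf, both sets are empty). -/
def runStep {X A : Obj.{u}} (R : Mor ((X.cbang C).tensor (A.cbang C)) A) :
    X.carrier ⊕ A.carrier → List (C × (X.carrier ⊕ A.carrier)) → Prop
  | .inl _, cs => cs = []
  | .inr b, cs => ∃ (w : Finset (C × X.carrier)) (v : Finset (C × A.carrier)),
      (∀ c x, (c, x) ∈ w ↔ (c, Sum.inl x) ∈ cs) ∧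
      (∀ c a, (c, a) ∈ v ↔ (c, Sum.inr a) ∈ cs) ∧ R.rel (w, v) b

/-- Semantic run-trees of `R` producing `a`. -/
def IsRunTree {X A : Obj.{u}} (R : Mor ((X.cbang C).tensor (A.cbang C)) A) (a : A.carrier)
    (t : List ℕ → Option (C × (X.carrier ⊕ A.carrier))) : Prop :=
  IsTree (runStep R) (⊥, Sum.inr a) t

/-- The elements of `X` at the leaves, coloured by the maximal colour on the path to the root. -/
def leaves {X A : Type u} (t : List ℕ → Option (C × (X ⊕ A))) : Set (C × X) :=
  {e | ∃ p c', t p = some (c', Sum.inl e.2) ∧ e.1 = pathColour t p}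

/-- The underlying relation of the fixpoint of `R`. -/
def fixRel (win : (ℕ → C) → Prop) {X A : Obj.{u}} (R : Mor ((X.cbang C).tensor (A.cbang C)) A)
    (w : Finset (C × X.carrier)) (a : A.carrier) : Prop :=
  ∃ t : List ℕ → Option (C × (X.carrier ⊕ A.carrier)),
    IsRunTree R a t ∧ TreeWins win t ∧ ∀ e, e ∈ w ↔ e ∈ leaves t

theorem fixRel_closed (win : (ℕ → C) → Prop) {X A : Obj.{u}}
    (R : Mor ((X.cbang C).tensor (A.cbang C)) A) {w w' : Finset (C × X.carrier)}
    {a a' : A.carrier} (h : fixRel win R w a) (hw : (X.cbang C).le w w') (ha : A.le a' a) :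
    fixRel win R w' a' := by
  obtain ⟨t, ht, hwin, hleaves⟩ := h
  obtain ⟨cs₀, hstep₀, hcs₀⟩ := ht.children [] ⊥ (.inr a) ht.root_eq
  -- replacement of the leaves
  have hφ : ∀ (c : C) (x : X.carrier), ∃ x' : X.carrier,
      (c, x) ∈ w → X.le x x' ∧ (c, x') ∈ w' := by
    intro c x
    by_cases hx : (c, x) ∈ w
    · obtain ⟨⟨c', x'⟩, hx', hc, hle⟩ := hw _ hx
      obtain rfl : c = c' := hc
      exact ⟨x', fun _ => ⟨hle, hx'⟩⟩
    · exact ⟨x, fun h => absurd h hx⟩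
  choose φ hφ using hφ
  let g : List ℕ → C × (X.carrier ⊕ A.carrier) → C × (X.carrier ⊕ A.carrier) :=
    fun p e => (e.1, Sum.map (φ (pathColour t p)) (fun b => b) e.2)
  let t' : List ℕ → Option (C × (X.carrier ⊕ A.carrier))
    | [] => some (⊥, .inr a')
    | k :: p => if k < cs₀.length then (t (k :: p)).map (g (k :: p)) else
        if p = [] then (w'.toList[k - cs₀.length]?).map (fun e => (e.1, Sum.inl e.2)) else none
  have t'_nil : t' [] = some (⊥, .inr a') := rfl
  have t'_lt : ∀ k p, k < cs₀.length → t' (k :: p) = (t (k :: p)).map (g (k :: p)) :=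
    fun k p hk => if_pos hk
  have t'_ge : ∀ k, ¬ k < cs₀.length →
      t' [k] = (w'.toList[k - cs₀.length]?).map (fun e => (e.1, Sum.inl e.2)) :=
    fun k hk => (if_neg hk).trans (if_pos rfl)
  have t'_none : ∀ k k' p, ¬ k < cs₀.length → t' (k :: k' :: p) = none :=
    fun k k' p hk => (if_neg hk).trans (if_neg (List.cons_ne_nil _ _))
  have hleaf : ∀ p c x, t p = some (c, .inl x) → (pathColour t p, x) ∈ w :=
    fun p c x hp => (hleaves _).2 ⟨p, c, hp, rfl⟩
  -- colours are preserved
  have hcol : ∀ p, (p = [] ∨ ∃ k q, p = k :: q ∧ k < cs₀.length) →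
      colourAt t' p = colourAt t p := by
    rintro p (rfl | ⟨k, q, rfl, hk⟩)
    · simp [colourAt, ht.root_eq, t']
    · simp only [colourAt, t'_lt k q hk]
      cases t (k :: q) <;> rfl
  have htake : ∀ (k : ℕ) (q : List ℕ) (i : ℕ), k < cs₀.length →
      ((k :: q).take i = [] ∨ ∃ k' q', (k :: q).take i = k' :: q' ∧ k' < cs₀.length) := by
    intro k q i hk
    cases i with
    | zero => exact .inl rfl
    | succ i => exact .inr ⟨k, q.take i, rfl, hk⟩
  have hpath : ∀ k q, k < cs₀.length → pathColour t' (k :: q) = pathColour t (k :: q) :=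
    fun k q hk => Finset.sup_congr rfl fun i _ => hcol _ (htake k q i hk)
  -- relabelled children still satisfy the local condition
  have hrel : ∀ (p : List ℕ) (cs cs' : List (C × (X.carrier ⊕ A.carrier)))
      (b b' : A.carrier), (∀ k, t (p ++ [k]) = cs[k]?) → runStep R (.inr b) cs → A.le b' b →
      (∀ c d, (c, Sum.inr d) ∈ cs' ↔ (c, Sum.inr d) ∈ cs) →
      (∀ k c x, cs[k]? = some (c, .inl x) →
        (c, Sum.inl (φ (pathColour t (p ++ [k])) x)) ∈ cs') →
      runStep R (.inr b') cs' := by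
    classical
    rintro p cs cs' b b' hk ⟨w₁, v₁, h₁, h₂, hR⟩ hb hA hX
    refine ⟨(cs'.filterMap fun e => e.2.elim (fun x => some (e.1, x)) fun _ => none).toFinset,
      v₁, ?_, ?_, R.closed hR ⟨?_, Obj.refl _ _⟩ hb⟩
    · intro c x
      simp only [List.mem_toFinset, List.mem_filterMap]
      constructor
      · rintro ⟨⟨c', y⟩, hy, hxy⟩
        cases y with
        | inl y => simp at hxy; obtain ⟨rfl, rfl⟩ := hxy; exact hy
        | inr y => simp at hxy
      · intro hx
        exact ⟨_, hx, rfl⟩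
    · intro c d
      rw [h₂, hA]
    · rintro ⟨c, x⟩ hx
      obtain ⟨k, hk'⟩ := List.mem_iff_getElem?.1 ((h₁ c x).1 hx)
      refine ⟨(c, φ (pathColour t (p ++ [k])) x), ?_, rfl,
        (hφ _ _ (hleaf _ c x ((hk k).trans hk'))).1⟩
      simp only [List.mem_toFinset, List.mem_filterMap]
      exact ⟨_, hX k c x hk', rfl⟩
  refine ⟨t', ⟨rfl, ?_, ?_⟩, ?_, ?_⟩
  · -- local conditions
    intro p c y hp
    cases p with
    | nil =>
      obtain ⟨rfl, rfl⟩ : ⊥ = c ∧ Sum.inr a' = y := by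
        have : some ((⊥ : C), (Sum.inr a' : X.carrier ⊕ A.carrier)) = some (c, y) := hp
        simpa using this
      refine ⟨(cs₀.mapIdx fun k e => g [k] e) ++ w'.toList.map fun e => (e.1, Sum.inl e.2),
        hrel [] cs₀ _ a a' hcs₀ hstep₀ ha ?_ ?_, ?_⟩
      · intro c d
        simp only [List.mem_append, List.mem_map, List.mem_mapIdx]
        constructor
        · rintro (⟨k, hk, hkk⟩ | ⟨e, -, he⟩)
          · rcases hy : cs₀[k] with ⟨c', y⟩
            rw [hy] at hkk
            cases y with
            | inl y => simp [g] at hkk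
            | inr y =>
              simp [g] at hkk
              obtain ⟨rfl, rfl⟩ := hkk
              exact hy ▸ List.getElem_mem hk
          · simp at he
        · intro hd
          obtain ⟨k, hk, hkk⟩ := List.getElem_of_mem hd
          exact .inl ⟨k, hk, by rw [hkk]; rfl⟩
      · intro k c x hk
        obtain ⟨hk', hkk⟩ := List.getElem?_eq_some_iff.1 hk
        simp only [List.mem_append, List.mem_mapIdx]
        exact .inl ⟨k, hk', by rw [hkk]; rfl⟩
      · intro k
        by_cases hk : k < cs₀.length
        · rw [List.getElem?_append_left (by simpa using hk)]
          have := hcs₀ k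
          simp only [List.nil_append] at this ⊢
          rw [t'_lt k [] hk, this]
          simp
        · rw [List.getElem?_append_right (by simpa using hk)]
          simp only [List.nil_append]
          rw [t'_ge k hk]
          simp
    | cons k q =>
      by_cases hk : k < cs₀.length
      · rw [t'_lt k q hk] at hp
        obtain ⟨⟨c₁, y₁⟩, hy₁, hg⟩ := Option.map_eq_some_iff.1 hp
        obtain ⟨cs, hstep, hcs⟩ := ht.children _ _ _ hy₁
        have hnext : ∀ j, t' ((k :: q) ++ [j]) =
            (cs.mapIdx fun j e => g ((k :: q) ++ [j]) e)[j]? := by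
          intro j
          have := hcs j
          simp only [List.cons_append] at this ⊢
          rw [t'_lt _ _ hk, this]
          simp
        cases y₁ with
        | inl x =>
          obtain rfl : cs = [] := hstep
          obtain rfl : Sum.inl _ = y := congrArg Prod.snd hg
          exact ⟨_, rfl, hnext⟩
        | inr b =>
          obtain rfl : Sum.inr b = y := congrArg Prod.snd hg
          refine ⟨_, hrel (k :: q) cs _ b b hcs hstep (A.refl b) ?_ ?_, hnext⟩
          · intro c d
            simp only [List.mem_mapIdx]
            constructor
            · rintro ⟨k, hk, hkk⟩
              rcases hy : cs[k] with ⟨c', y⟩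
              rw [hy] at hkk
              cases y with
              | inl y => simp [g] at hkk
              | inr y =>
                simp [g] at hkk
                obtain ⟨rfl, rfl⟩ := hkk
                exact hy ▸ List.getElem_mem hk
            · intro hd
              obtain ⟨k, hk, hkk⟩ := List.getElem_of_mem hd
              exact ⟨k, hk, by rw [hkk]; rfl⟩
          · intro j c x hj
            obtain ⟨hk', hkk⟩ := List.getElem?_eq_some_iff.1 hj
            simp only [List.mem_mapIdx]
            exact ⟨j, hk', by rw [hkk]; rfl⟩
      · cases q with
        | nil =>
          rw [t'_ge k hk] at hp
          obtain ⟨e, -, hg⟩ := Option.map_eq_some_iff.1 hp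
          obtain rfl : Sum.inl _ = y := congrArg Prod.snd hg
          exact ⟨[], rfl, fun j => by simp [t'_none _ _ _ hk]⟩
        | cons k' q => rw [t'_none _ _ _ hk] at hp; simp at hp
  · -- no nodes below missing nodes
    intro p k hp
    cases p with
    | nil => cases hp
    | cons j q =>
      by_cases hj : j < cs₀.length
      · rw [t'_lt j q hj] at hp
        have := ht.none_of_none (j :: q) k (Option.map_eq_none_iff.1 hp)
        simp only [List.cons_append] at this ⊢
        rw [t'_lt _ _ hj, this]; rfl
      · cases q <;> exact t'_none _ _ _ hj
  · -- branches
    intro f hf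
    have hpre : ∀ n, prefixAt f (n + 1) = f 0 :: (List.range n).map (fun i => f (i + 1)) := by
      intro n
      simp [prefixAt, List.range_succ_eq_map, Function.comp_def]
    have hf0 : f 0 < cs₀.length := by
      by_contra hlt
      refine hf 2 ?_
      rw [hpre]
      exact t'_none _ _ _ hlt
    have hcolf : ∀ n, colourAt t' (prefixAt f n) = colourAt t (prefixAt f n) := by
      intro n
      apply hcol
      cases n with
      | zero => exact .inl rfl
      | succ n => exact .inr ⟨_, _, hpre n, hf0⟩
    simp only [hcolf]
    apply hwin f
    intro n hn
    cases n with
    | zero =>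
      have := ht.root_eq
      rw [show prefixAt f 0 = [] from rfl, this] at hn
      cases hn
    | succ n =>
      refine hf (n + 1) ?_
      rw [hpre] at hn ⊢
      rw [t'_lt _ _ hf0, hn]; rfl
  · -- leaves
    rintro ⟨c, x⟩
    constructor
    · intro hx
      obtain ⟨j, hj⟩ := List.mem_iff_getElem?.1 (Finset.mem_toList.2 hx)
      have h1 : t' [cs₀.length + j] = some (c, .inl x) := by
        rw [t'_ge _ (by omega), Nat.add_sub_cancel_left, hj]; rfl
      refine ⟨[cs₀.length + j], c, h1, ?_⟩
      simp [pathColour, Finset.range_add_one, colourAt, h1, t'_nil]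
    · rintro ⟨p, c', hp, hc⟩
      dsimp only at hp hc
      cases p with
      | nil => cases hp
      | cons k q =>
        by_cases hk : k < cs₀.length
        · rw [hpath k q hk] at hc
          rw [t'_lt k q hk] at hp
          obtain ⟨⟨c₁, y₁⟩, hy₁, hg⟩ := Option.map_eq_some_iff.1 hp
          cases y₁ with
          | inr b => simp [g] at hg
          | inl x₁ =>
            simp [g] at hg
            rw [← hg.2, hc]
            exact (hφ _ _ (hleaf _ _ _ hy₁)).2
        · cases q with
          | cons k' q => rw [t'_none _ _ _ hk] at hp; simp at hp
          | nil =>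
            have hpk := hp
            rw [t'_ge k hk] at hp
            obtain ⟨e, he, hg⟩ := Option.map_eq_some_iff.1 hp
            have hmem := Finset.mem_toList.1 (List.mem_of_getElem? he)
            simp at hg
            have hcc : c = c' := by
              rw [hc]
              simp [pathColour, Finset.range_add_one, colourAt, hpk, t'_nil]
            rw [hcc, ← hg.1, ← hg.2]
            exact hmem

/-- The fixpoint operator, from `R : !□X ⊗ !□A → A` to a morphism `!□X → A`. -/
def Mor.fixpoint (win : (ℕ → C) → Prop) {X A : Obj.{u}}
    (R : Mor ((X.cbang C).tensor (A.cbang C)) A) : Mor (X.cbang C) A where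
  rel := fixRel win R
  closed := fixRel_closed win R

end Trees

/-! ### Alternating parity automata -/

/-- An alternating parity tree automaton with states `Q` over the ranked alphabet `(Sig, ar)`:
`δ q a` is the finite set of conjunctive clauses of the transition formula, a clause being a finite
set of pairs (direction, state), and `Ω` is the colouring function. -/
structure APT (Q : Type u) {Sig : Type v} (ar : Sig → ℕ) where
  δ : Q → (a : Sig) → Finset (Finset (Fin (ar a) × Q))
  Ω : Q → ℕ

namespace APT

variable {Q : Type u} {Sig : Type v} {ar : Sig → ℕ} (𝒜 : APT Q ar)

/-- The colours `Ω(Q) ⊎ {ε}`, where the neutral colour `ε` is the added least element `⊥`. -/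
abbrev Col : Type := WithBot (Set.range 𝒜.Ω)

/-- The colour of a state, as an element of `Col`. -/
def colour (q : Q) : 𝒜.Col := ((⟨𝒜.Ω q, q, rfl⟩ : Set.range 𝒜.Ω) : WithBot (Set.range 𝒜.Ω))

/-- A sequence of colours is winning if some non-neutral colour occurs infinitely often, and the
greatest such colour is even. -/
def WinSeq (s : ℕ → 𝒜.Col) : Prop :=
  ∃ m : Set.range 𝒜.Ω, (∃ᶠ n in Filter.atTop, s n = (m : WithBot (Set.range 𝒜.Ω))) ∧
    (∀ m' : Set.range 𝒜.Ω,
      (∃ᶠ n in Filter.atTop, s n = (m' : WithBot (Set.range 𝒜.Ω))) → m' ≤ m) ∧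
    Even (m : ℕ)

/-- The tuple `α` of sets of coloured states satisfies the formula `δ q a`. -/
def Satisfies (q : Q) (a : Sig) (α : Fin (ar a) → Finset (𝒜.Col × Q)) : Prop :=
  ∃ J : Fin (ar a) → Finset (𝒜.Col × Q), (∀ k, J k ⊆ α k) ∧
    (∃ φ ∈ 𝒜.δ q a, ∀ k q', (k, q') ∈ φ ↔ ∃ c, (c, q') ∈ J k) ∧
    ∀ k c q', (c, q') ∈ J k → c = 𝒜.colour q'

/-! ### Interpretation of λY-terms -/

/-- The interpretation of simple types. -/
def sem : Ty → Obj.{u}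
  | .o => ⟨Q, (· = ·), fun _ => rfl, fun h h' => h.trans h'⟩
  | .arr σ τ => ((sem σ).cbang 𝒜.Col).lolli (sem τ)

/-- The interpretation `⟦σ₁⟧ & ⋯ & ⟦σₙ⟧` of a context as an object of the Kleisli category. -/
def semCtx : List Ty → Obj.{u}
  | [] => Obj.top
  | σ :: Γ => (semCtx Γ).prod (𝒜.sem σ)

/-- The injection of the component of the variable `x` in `⟦σ₁⟧ & ⋯ & ⟦σₙ⟧`. -/
def inj : {Γ : List Ty} → {σ : Ty} → Var Γ σ → (𝒜.sem σ).carrier → (𝒜.semCtx Γ).carrier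
  | _, _, .zero, a => Sum.inr a
  | _, _, .succ x, a => Sum.inl (inj x a)

theorem inj_le : ∀ {Γ : List Ty} {σ : Ty} (x : Var Γ σ) {a b : (𝒜.sem σ).carrier},
    (𝒜.sem σ).le a b → (𝒜.semCtx Γ).le (𝒜.inj x a) (𝒜.inj x b)
  | _, _, .zero, _, _, h => Sum.LiftRel.inr h
  | _, _, .succ x, _, _, h => Sum.LiftRel.inl (inj_le x h)

/-- The projection `⟦σ₁⟧ & ⋯ & ⟦σₙ⟧ → ⟦σ⟧` on the component of a variable. -/
def proj {Γ : List Ty} {σ : Ty} (x : Var Γ σ) : Mor (𝒜.semCtx Γ) (𝒜.sem σ) where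
  rel y a := ∃ a', y = 𝒜.inj x a' ∧ (𝒜.sem σ).le a a'
  closed := by
    rintro y y' a b ⟨a', rfl, h⟩ hy hb
    suffices H : ∀ {Γ : List Ty} {σ : Ty} (x : Var Γ σ) (a' : (𝒜.sem σ).carrier)
        (y' : (𝒜.semCtx Γ).carrier), (𝒜.semCtx Γ).le (𝒜.inj x a') y' →
        ∃ a'', y' = 𝒜.inj x a'' ∧ (𝒜.sem σ).le a' a'' by
      obtain ⟨a'', rfl, h'⟩ := H x a' y' hy
      exact ⟨a'', rfl, Obj.trans _ hb (Obj.trans _ h h')⟩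
    intro Γ σ x
    induction x with
    | zero =>
      intro a' y' h
      cases h with
      | inr h => exact ⟨_, rfl, h⟩
    | succ x ih =>
      intro a' y' h
      cases h with
      | inl h =>
        obtain ⟨a'', rfl, h'⟩ := ih _ _ h
        exact ⟨a'', rfl, h'⟩

/-- The element `(α₁, …, αₙ, q)` of `⟦o → ⋯ → o → o⟧`. -/
def conElt : (n : ℕ) → (Fin n → Finset (𝒜.Col × Q)) → Q → (𝒜.sem (Ty.ofArity n)).carrier
  | 0, _, q => q
  | n + 1, α, q => (α 0, conElt n (fun i => α i.succ) q)

theorem conElt_le : ∀ (n : ℕ) (α : Fin n → Finset (𝒜.Col × Q)) (q : Q)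
    (b : (𝒜.sem (Ty.ofArity n)).carrier), (𝒜.sem (Ty.ofArity n)).le b (𝒜.conElt n α q) →
    ∃ β : Fin n → Finset (𝒜.Col × Q), (∀ i, α i ⊆ β i) ∧ b = 𝒜.conElt n β q
  | 0, _, _, _, h => ⟨Fin.elim0, fun i => i.elim0, h⟩
  | n + 1, α, q, b, h => by
    obtain ⟨β, hβ, hb⟩ := conElt_le n (fun i => α i.succ) q b.2 h.2
    refine ⟨Fin.cons b.1 β, ?_, ?_⟩
    · intro i
      refine Fin.cases ?_ (fun i => ?_) i
      · intro e he
        obtain ⟨e', he', hc, hq⟩ := h.1 e he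
        have : e = e' := Prod.ext hc hq
        subst this
        exact he'
      · exact hβ i
    · exact Prod.ext rfl hb

/-- The interpretation of a constructor `a`, precomposed with the weakening `!□⟦Γ⟧ → 1`. -/
def semCon (Γ : List Ty) (a : Sig) :
    Mor ((𝒜.semCtx Γ).cbang 𝒜.Col) (𝒜.sem (Ty.ofArity (ar a))) where
  rel _ s := ∃ α q, s = 𝒜.conElt (ar a) α q ∧ 𝒜.Satisfies q a α
  closed := by
    rintro _ _ s s' ⟨α, q, rfl, J, hJ, h⟩ - hs
    obtain ⟨β, hβ, rfl⟩ := 𝒜.conElt_le _ _ _ _ hs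
    exact ⟨β, q, rfl, J, fun k => (hJ k).trans (hβ k), h⟩

/-- Interpretation of terms in the Kleisli category of `!□`. -/
def semTm : {Γ : List Ty} → {σ : Ty} → Tm ar Γ σ →
    Mor ((𝒜.semCtx Γ).cbang 𝒜.Col) (𝒜.sem σ)
  | Γ, _, .var x => (Mor.der 𝒜.Col (𝒜.semCtx Γ)).comp (𝒜.proj x)
  | Γ, _, .con a => 𝒜.semCon Γ a
  | Γ, .arr σ _, .lam M =>
      ((Mor.seely 𝒜.Col (𝒜.semCtx Γ) (𝒜.sem σ)).comp (semTm M)).curry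
  | Γ, τ, .app (σ := σ) M N =>
      ((Mor.contr 𝒜.Col (𝒜.semCtx Γ)).comp
        ((semTm M).tensor
          ((Mor.dig 𝒜.Col (𝒜.semCtx Γ)).comp (Mor.cbang 𝒜.Col (semTm N))))).comp
        (Mor.ev ((𝒜.sem σ).cbang 𝒜.Col) (𝒜.sem τ))
  | _, _, .fix M => Mor.fixpoint 𝒜.WinSeq (semTm M).uncurry

/-- The object `!□⟦σ₁⟧ ⊗ ⋯ ⊗ !□⟦σₙ⟧`: tuples `(u₁, …, uₙ)` indexed by the variables. -/
def env (Γ : List Ty) : Obj.{u} where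
  carrier := ∀ σ, Var Γ σ → Finset (𝒜.Col × (𝒜.sem σ).carrier)
  le ρ ρ' := ∀ σ x, ((𝒜.sem σ).cbang 𝒜.Col).le (ρ σ x) (ρ' σ x)
  refl _ _ _ := Obj.refl _ _
  trans h h' σ x := Obj.trans _ (h σ x) (h' σ x)

/-- The Seely isomorphism `!□⟦σ₁⟧ ⊗ ⋯ ⊗ !□⟦σₙ⟧ → !□(⟦σ₁⟧ & ⋯ & ⟦σₙ⟧)`. -/
def seelyCtx (Γ : List Ty) : Mor (𝒜.env Γ) ((𝒜.semCtx Γ).cbang 𝒜.Col) where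
  rel ρ w := ∀ e ∈ w, ∃ σ, ∃ x : Var Γ σ, ∃ a, (e.1, a) ∈ ρ σ x ∧
    (𝒜.semCtx Γ).le e.2 (𝒜.inj x a)
  closed := by
    rintro ρ ρ' w w' h hρ hw e he
    obtain ⟨e₁, he₁, hc, hle⟩ := hw e he
    obtain ⟨σ, x, a, ha, hle'⟩ := h e₁ he₁
    obtain ⟨⟨c, a'⟩, ha', hc', hle''⟩ := hρ σ x _ ha
    obtain rfl : e₁.1 = c := hc'
    refine ⟨σ, x, a', ?_, Obj.trans _ hle (Obj.trans _ hle' (𝒜.inj_le x hle''))⟩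
    rw [hc]; exact ha'

/-- The interpretation `⟦Γ ⊢ t :: τ⟧ : !□⟦σ₁⟧ ⊗ ⋯ ⊗ !□⟦σₙ⟧ → ⟦τ⟧`. -/
def interp {Γ : List Ty} {τ : Ty} (t : Tm ar Γ τ) : Mor (𝒜.env Γ) (𝒜.sem τ) :=
  (𝒜.seelyCtx Γ).comp (𝒜.semTm t)

/-! ### The coloured intersection type system -/

/-- The assignment of a set of coloured intersection types to each variable of `Γ`. -/
abbrev Env (Γ : List Ty) : Type u := (𝒜.env Γ).carrier

/-- Extension `Γ, x : u`. -/
def Env.cons {𝒜 : APT Q ar} {Γ : List Ty} {σ : Ty} (ρ : 𝒜.Env Γ)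
    (u : Finset (𝒜.Col × (𝒜.sem σ).carrier)) : 𝒜.Env (σ :: Γ)
  | _, .zero => u
  | _, .succ x => ρ _ x

open Classical in
/-- The set `{(max c cᵢ, αᵢ)}` obtained from `{(cᵢ, αᵢ)}`. -/
noncomputable def recolour {A : Type u} (c : 𝒜.Col) (u : Finset (𝒜.Col × A)) :
    Finset (𝒜.Col × A) :=
  u.image fun e => (max c e.1, e.2)

open Classical in
/-- The context `Γ₀ ∪ □_{c₁} Γ₁ ∪ ⋯ ∪ □_{cₙ} Γₙ`. -/
noncomputable def Env.join {𝒜 : APT Q ar} {Γ : List Ty} (ρ₀ : 𝒜.Env Γ) {n : ℕ}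
    (c : Fin n → 𝒜.Col) (ρ : Fin n → 𝒜.Env Γ) : 𝒜.Env Γ :=
  fun σ x => ρ₀ σ x ∪ Finset.univ.biUnion fun i => 𝒜.recolour (c i) (ρ i σ x)

open Classical in
/-- The intersection type `{(c₁, β₁), …, (cₙ, βₙ)} → α`. -/
noncomputable def arrow {σ τ : Ty} {n : ℕ} (c : Fin n → 𝒜.Col)
    (β : Fin n → (𝒜.sem σ).carrier) (α : (𝒜.sem τ).carrier) : (𝒜.sem (.arr σ τ)).carrier :=
  (Finset.univ.image fun i => (c i, β i), α)

/-- Sequents `x₁ : u₁ :: σ₁, …, xₙ : uₙ :: σₙ ⊢ t : α :: τ`. -/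
structure Sequent where
  ctx : List Ty
  type : Ty
  term : Tm ar ctx type
  env : 𝒜.Env ctx
  elt : (𝒜.sem type).carrier

/-- The typing rules: `RuleAt t ρ α ps` says that the sequent `ρ ⊢ t : α` is the conclusion of an
instance of a rule whose premises, with their colours, are `ps`. The rules for variables and
constructors hold in an arbitrary context (weakening). -/
def RuleAt : {Γ : List Ty} → {τ : Ty} → Tm ar Γ τ → 𝒜.Env Γ → (𝒜.sem τ).carrier →
    List (𝒜.Col × 𝒜.Sequent) → Prop
  | _, τ, .var x, ρ, α, ps => ps = [] ∧ ∃ α', (⊥, α') ∈ ρ τ x ∧ (𝒜.sem τ).le α α'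
  | _, _, .con a, _, s, ps => ps = [] ∧ ∃ α q, s = 𝒜.conElt (ar a) α q ∧ 𝒜.Satisfies q a α
  | Γ, .arr σ τ, .lam M, ρ, α, ps => ps = [(⊥, ⟨σ :: Γ, τ, M, ρ.cons α.1, α.2⟩)]
  | Γ, τ, .app (σ := σ) M N, ρ, α, ps =>
      ∃ (n : ℕ) (c : Fin n → 𝒜.Col) (β : Fin n → (𝒜.sem σ).carrier)
        (ρ₀ : 𝒜.Env Γ) (ρ' : Fin n → 𝒜.Env Γ), ρ = ρ₀.join c ρ' ∧
        ps = (⊥, ⟨Γ, .arr σ τ, M, ρ₀, 𝒜.arrow c β α⟩) ::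
          List.ofFn fun i => (⊥, ⟨Γ, σ, N, ρ' i, β i⟩)
  | Γ, σ, .fix M, ρ, α, ps =>
      ∃ (n : ℕ) (c : Fin n → 𝒜.Col) (β : Fin n → (𝒜.sem σ).carrier)
        (ρ₀ : 𝒜.Env Γ) (ρ' : Fin n → 𝒜.Env Γ), ρ = ρ₀.join c ρ' ∧
        ps = (⊥, ⟨Γ, .arr σ σ, M, ρ₀, 𝒜.arrow c β α⟩) ::
          List.ofFn fun i => (c i, ⟨Γ, σ, .fix M, ρ' i, β i⟩)

/-- The typing rules, as a relation between a sequent and the list of coloured premises. -/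
def Rule (s : 𝒜.Sequent) (ps : List (𝒜.Col × 𝒜.Sequent)) : Prop :=
  𝒜.RuleAt s.term s.env s.elt ps

/-- The sequent has a winning, possibly infinite, derivation tree. -/
def HasWinningDerivation (s : 𝒜.Sequent) : Prop :=
  ∃ D : List ℕ → Option (𝒜.Col × 𝒜.Sequent), IsTree 𝒜.Rule (⊥, s) D ∧ TreeWins 𝒜.WinSeq D

end APT

end ColScott

/-! The interpretation of a term is evaluated at one finite set, `flat ρ`, the greatest element
related to the tuple `ρ` by the Seely isomorphism (`interp_rel_iff`). The equivalence is then an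
induction on terms.

Winning depends only on tails of colour sequences, so a sequent has a winning derivation iff it is
the conclusion of a rule all of whose premises have one (`hasWinTree_iff`). This settles variables,
constants and abstraction. For application, the comultiplication amounts to finding, for each `(c,
β)` in the argument, some `w'` with `□_c w'` below the context that produces `β`. This matches the
rule (App). Rebuilding a derivation requires a context for each premise, and the residual `{(d, a) |
(max c d, a) ∈ ρ}` is a canonical choice: it contains every candidate up to the order, it is finite
because there are finitely many colours, and joining it back adds nothing.

For `Y M`, the sequents about `Y M` reached from the root through premises about `Y M` form a
coloured spine, off which hang derivations for `M`. Replacing the latter by the contexts they use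
turns the spine into a semantic run-tree. Conversely, a node of a run-tree becomes a sequent whose
context is the residual of `ρ` by the colour of the path to the root. In both directions an infinite
branch either follows the given winning tree forever or leaves it for good into another winning
tree. `HasWinTree.of_simulation` captures this argument. -/

namespace ColScott

/-! ### Winning trees: unfolding, simulation, subtrees -/

section WinningTrees

variable {C : Type} [LinearOrder C] [OrderBot C] {L : Type u}

/-- `x` is the label of the root of a winning tree for `step`. -/
def HasWinTree (step : L → List (C × L) → Prop) (win : (ℕ → C) → Prop) (x : L) : Prop :=
  ∃ t : List ℕ → Option (C × L), IsTree step (⊥, x) t ∧ TreeWins win t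

/-- A winning condition which only depends on the tails of a sequence. -/
def TailInvariant (win : (ℕ → C) → Prop) : Prop :=
  ∀ (s : ℕ → C) (k : ℕ), win (fun n => s (n + k)) ↔ win s

theorem prefixAt_succ (f : ℕ → ℕ) (n : ℕ) : prefixAt f (n + 1) = prefixAt f n ++ [f n] := by
  simp [prefixAt, List.range_succ]

theorem ne_none_of_append {α : Type*} {t : List ℕ → Option α}
    (ht : ∀ p k, t p = none → t (p ++ [k]) = none) (p q : List ℕ) (h : t (p ++ q) ≠ none) :
    t p ≠ none := by
  induction q using List.reverseRecOn with
  | nil => simpa using h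
  | append_singleton q k ih =>
    exact ih fun h' => h (by rw [← List.append_assoc]; exact ht _ _ h')

/-- In a winning tree, every infinite path wins, wherever it starts. -/
theorem TreeWins.win_path {win : (ℕ → C) → Prop} (hwin : TailInvariant win)
    {t : List ℕ → Option (C × L)} (ht : ∀ p k, t p = none → t (p ++ [k]) = none)
    (h : TreeWins win t) (p : ℕ → List ℕ) (hp : ∀ n, ∃ k, p (n + 1) = p n ++ [k])
    (hne : ∀ n, t (p n) ≠ none) : win fun n => colourAt t (p n) := by
  choose k hk using hp
  -- The branch `f` first walks from the root to `p 0`, then follows the path; the path is thus a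
  -- tail of a full branch, and tail invariance applies.
  let f : ℕ → ℕ := fun i => if hi : i < (p 0).length then (p 0)[i] else k (i - (p 0).length)
  have hf : ∀ n, prefixAt f (n + (p 0).length) = p n := by
    intro n
    induction n with
    | zero =>
      refine List.ext_getElem (by simp [prefixAt]) fun i h₁ h₂ => ?_
      simp [prefixAt, f, h₂]
    | succ n ih =>
      rw [Nat.add_right_comm, prefixAt_succ, ih, hk]
      simp [f]
  have hpre : ∀ n m, ∃ q, prefixAt f (n + m) = prefixAt f n ++ q := by
    intro n m
    induction m with
    | zero => exact ⟨[], by simp⟩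
    | succ m ih =>
      obtain ⟨q, hq⟩ := ih
      exact ⟨q ++ [f (n + m)], by rw [← Nat.add_assoc, prefixAt_succ, hq, List.append_assoc]⟩
  have := h f fun n => by
    obtain ⟨q, hq⟩ := hpre n (p 0).length
    refine ne_none_of_append ht _ q ?_
    rw [← hq, hf]
    exact hne n
  rw [← hwin _ (p 0).length] at this
  simpa only [hf] using this

/-- Unfolding of a coalgebra into a tree. -/
theorem exists_unfolding {S : Type*} {step : L → List (C × L) → Prop} (lab : S → L)
    (V : S → Prop) (next : S → C × S → Prop)
    (h : ∀ s, V s → ∃ cs : List (C × S), step (lab s) (cs.map (Prod.map id lab)) ∧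
      ∀ e ∈ cs, V e.2 ∧ next s e) (s₀ : S) (hs₀ : V s₀) :
    ∃ T : List ℕ → Option (C × S), T [] = some (⊥, s₀) ∧
      IsTree step (⊥, lab s₀) (fun p => (T p).map (Prod.map id lab)) ∧
      (∀ p e, T p = some e → V e.2) ∧
      ∀ p k e e', T p = some e → T (p ++ [k]) = some e' → next e.2 e' := by
  classical
  choose! ch hch using h
  -- An address is followed index by index through the chosen lists of children; an index out of
  -- range gives `none`, which `bind` propagates downwards.
  let T : List ℕ → Option (C × S) := fun p =>
    p.foldl (fun o k => o.bind fun e => (ch e.2)[k]?) (some (⊥, s₀))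
  have hT : ∀ p k, T (p ++ [k]) = (T p).bind fun e => (ch e.2)[k]? := by
    intro p k
    simp [T]
  have hV : ∀ p e, T p = some e → V e.2 := by
    intro p
    induction p using List.reverseRecOn with
    | nil =>
      intro e he
      obtain rfl : (⊥, s₀) = e := Option.some.inj he
      exact hs₀
    | append_singleton p k ih =>
      intro e he
      rw [hT] at he
      obtain ⟨e', he', hk⟩ := Option.bind_eq_some_iff.1 he
      exact ((hch _ (ih e' he')).2 e (List.mem_of_getElem? hk)).1
  refine ⟨T, rfl, ⟨rfl, ?_, ?_⟩, hV, ?_⟩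
  · intro p c x hp
    obtain ⟨e, he, hx⟩ := Option.map_eq_some_iff.1 hp
    obtain rfl : lab e.2 = x := congrArg Prod.snd hx
    refine ⟨_, (hch _ (hV p e he)).1, fun k => ?_⟩
    rw [hT, he]
    simp
  · intro p k hp
    rw [hT, Option.map_eq_none_iff.1 hp]
    rfl
  · intro p k e e' he he'
    rw [hT, he] at he'
    exact ((hch _ (hV p e he)).2 e' (List.mem_of_getElem? he')).2

theorem exists_list_map {α β : Type*} (f : α → β) (P : α → Prop) (l : List β)
    (h : ∀ b ∈ l, ∃ a, f a = b ∧ P a) : ∃ l' : List α, l'.map f = l ∧ ∀ a ∈ l', P a := by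
  induction l with
  | nil => exact ⟨[], rfl, by simp⟩
  | cons b l ih =>
    obtain ⟨a, ha, hPa⟩ := h b (by simp)
    obtain ⟨l', hl', hP⟩ := ih fun b hb => h b (List.mem_cons_of_mem _ hb)
    refine ⟨a :: l', by rw [List.map_cons, ha, hl'], ?_⟩
    rintro a' ha'
    rcases List.mem_cons.1 ha' with rfl | ha'
    · exact hPa
    · exact hP _ ha'

/-- Simulation: a tree which follows the branches of a winning tree `t`, except that at each node
some of the subtrees are replaced by winning trees, is winning. -/
theorem HasWinTree.of_simulation {L₁ : Type*} {step : L → List (C × L) → Prop}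
    {win : (ℕ → C) → Prop} (hwin : TailInvariant win) {t : List ℕ → Option (C × L₁)}
    (ht : ∀ p k, t p = none → t (p ++ [k]) = none) (htw : TreeWins win t)
    (I : List ℕ → L → Prop) (hI : ∀ p y, I p y → t p ≠ none)
    (hstep : ∀ p y, I p y → ∃ cs, step y cs ∧ ∀ e ∈ cs, HasWinTree step win e.2 ∨
      ∃ k, (t (p ++ [k])).map Prod.fst = some e.1 ∧ I (p ++ [k]) e.2)
    (p₀ : List ℕ) (y₀ : L) (h₀ : I p₀ y₀) : HasWinTree step win y₀ := by
  -- A state is a label together with a position: either in the guiding tree `t` (`inl`), or in a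
  -- winning tree `T` that has replaced a subtree (`inr`).
  let V : L × (List ℕ ⊕ (List ℕ → Option (C × L)) × List ℕ) → Prop
    | (y, .inl p) => I p y
    | (y, .inr (T, q)) => (∃ x, IsTree step (⊥, x) T) ∧ TreeWins win T ∧ ∃ c, T q = some (c, y)
  -- A move may go from `t` into some `T`, but never back nor from one `T` to another, so every
  -- branch eventually stays in a single winning tree.
  let next : L × (List ℕ ⊕ (List ℕ → Option (C × L)) × List ℕ) →
      C × L × (List ℕ ⊕ (List ℕ → Option (C × L)) × List ℕ) → Prop
    | (_, .inl p), (c, _, .inl p') => ∃ k, p' = p ++ [k] ∧ colourAt t p' = c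
    | (_, .inl _), (_, _, .inr _) => True
    | (_, .inr _), (_, _, .inl _) => False
    | (_, .inr (T, q)), (c, _, .inr (T', q')) => T' = T ∧ (∃ k, q' = q ++ [k]) ∧ colourAt T q' = c
  obtain ⟨T, hT₀, hT, hV, hnext⟩ := exists_unfolding (step := step) Prod.fst V next (by
    rintro ⟨y, p | ⟨T, q⟩⟩ hs
    · obtain ⟨cs, hcs, hch⟩ := hstep p y hs
      obtain ⟨l, rfl, hl⟩ := exists_list_map (Prod.map id Prod.fst)
        (fun e => V e.2 ∧ next (y, .inl p) e) cs (by
          rintro ⟨c, z⟩ hz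
          rcases hch _ hz with ⟨T, hT, hTw⟩ | ⟨k, hk, hIk⟩
          · exact ⟨(c, z, .inr (T, [])), rfl, ⟨⟨_, hT⟩, hTw, _, hT.root_eq⟩, trivial⟩
          · refine ⟨(c, z, .inl (p ++ [k])), rfl, hIk, k, rfl, ?_⟩
            obtain ⟨e, he, rfl⟩ := Option.map_eq_some_iff.1 hk
            simp [colourAt, he])
      exact ⟨l, hcs, hl⟩
    · obtain ⟨⟨x, hT⟩, hTw, c, hq⟩ := hs
      obtain ⟨cs, hcs, hch⟩ := hT.children _ _ _ hq
      obtain ⟨l, rfl, hl⟩ := exists_list_map (Prod.map id Prod.fst)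
        (fun e => V e.2 ∧ next (y, .inr (T, q)) e) cs (by
          rintro ⟨c, z⟩ hz
          obtain ⟨k, hk⟩ := List.mem_iff_getElem?.1 hz
          have hk' := (hch k).trans hk
          exact ⟨(c, z, .inr (T, q ++ [k])), rfl, ⟨⟨x, hT⟩, hTw, _, hk'⟩, rfl, ⟨k, rfl⟩,
            by simp [colourAt, hk']⟩)
      exact ⟨l, hcs, hl⟩) (y₀, .inl p₀) h₀
  refine ⟨_, hT, fun f hf => ?_⟩
  have hf' : ∀ n, ∃ e, T (prefixAt f n) = some e := fun n =>
    Option.ne_none_iff_exists'.1 fun h => hf n (by rw [h]; rfl)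
  choose e he using hf'
  have hcol : (fun n => colourAt (fun p => (T p).map (Prod.map id Prod.fst)) (prefixAt f n)) =
      fun n => (e n).1 := by
    funext n
    simp [colourAt, he]
  rw [hcol]
  have hVe : ∀ n, V (e n).2 := fun n => hV _ _ (he n)
  have hne : ∀ n, next (e n).2 (e (n + 1)) := fun n =>
    hnext _ (f n) _ _ (he n) (by rw [← prefixAt_succ]; exact he _)
  by_cases hall : ∀ n, ∃ p, (e n).2.2 = .inl p
  · choose p hp using hall
    have hne' : ∀ n, ∃ k, p (n + 1) = p n ++ [k] ∧ colourAt t (p (n + 1)) = (e (n + 1)).1 := by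
      intro n
      have h₁ := hp n
      have h₂ := hp (n + 1)
      have h := hne n
      generalize e n = z at h h₁ ⊢
      generalize e (n + 1) = z' at h h₂ ⊢
      rcases z with ⟨c, y, s⟩
      rcases z' with ⟨c', y', s'⟩
      obtain rfl : s = _ := h₁
      obtain rfl : s' = _ := h₂
      exact h
    have := htw.win_path hwin ht p (fun n => (hne' n).imp fun _ h => h.1) fun n => by
      have h₁ := hp n
      have h := hVe n
      generalize e n = z at h h₁
      rcases z with ⟨c, y, s⟩
      obtain rfl : s = _ := h₁
      exact hI _ _ h
    -- The first colours may differ: the new root has colour `⊥`, whatever the colour of `t` at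
    -- `p₀`.
    rw [← hwin _ 1] at this ⊢
    convert this using 2 with n
    exact (hne' n).choose_spec.2.symm
  · push Not at hall
    obtain ⟨N, hN⟩ := hall
    obtain ⟨⟨T', q₀⟩, hN⟩ : ∃ s, (e N).2.2 = .inr s := by
      rcases h : (e N).2.2 with p | s
      · exact absurd h (hN p)
      · exact ⟨s, rfl⟩
    have hrun : ∀ n, ∃ q, (e (n + N)).2.2 = .inr (T', q) := by
      intro n
      induction n with
      | zero => exact ⟨q₀, by simpa using hN⟩
      | succ n ih =>
        obtain ⟨q, hq⟩ := ih
        have h := hne (n + N)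
        rw [Nat.add_right_comm]
        generalize e (n + N) = z at h hq
        generalize e (n + N + 1) = z' at h ⊢
        rcases z with ⟨c, y, s⟩
        rcases z' with ⟨c', y', p' | ⟨T'', q'⟩⟩
        · obtain rfl : s = _ := hq
          exact h.elim
        · obtain rfl : s = _ := hq
          exact ⟨q', by rw [h.1]⟩
    choose q hq using hrun
    have hVq : ∀ n, (∃ x, IsTree step (⊥, x) T') ∧ TreeWins win T' ∧ T' (q n) ≠ none := by
      intro n
      have h₁ := hq n
      have h := hVe (n + N)
      generalize e (n + N) = z at h h₁
      rcases z with ⟨c, y, s⟩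
      obtain rfl : s = _ := h₁
      obtain ⟨h, h', _, h''⟩ := h
      exact ⟨h, h', by rw [h'']; simp⟩
    have hne' : ∀ n, (∃ k, q (n + 1) = q n ++ [k]) ∧
        colourAt T' (q (n + 1)) = (e (n + 1 + N)).1 := by
      intro n
      have h₁ := hq n
      have h₂ := hq (n + 1)
      have h := hne (n + N)
      rw [Nat.add_right_comm] at h₂ ⊢
      generalize e (n + N) = z at h h₁
      generalize e (n + N + 1) = z' at h h₂ ⊢
      rcases z with ⟨c, y, s⟩
      rcases z' with ⟨c', y', s'⟩
      obtain rfl : s = _ := h₁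
      obtain rfl : s' = _ := h₂
      exact h.2
    obtain ⟨⟨x, hT'⟩, hTw, -⟩ := hVq 0
    have := hTw.win_path hwin hT'.none_of_none q (fun n => (hne' n).1) fun n => (hVq n).2.2
    rw [← hwin _ 1] at this
    -- Besides the `N` steps before the inner tree is known to be entered, one more is dropped: the
    -- entry node keeps the colour given by `step`, whereas the root of `T'` has its own.
    rw [← hwin _ N, ← hwin _ 1]
    convert this using 2 with n
    exact (hne' n).2.symm

/-- The subtrees of a winning tree are winning. -/
theorem HasWinTree.of_subtree {step : L → List (C × L) → Prop} {win : (ℕ → C) → Prop}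
    (hwin : TailInvariant win) {x : C × L} {t : List ℕ → Option (C × L)} (ht : IsTree step x t)
    (htw : TreeWins win t) {p : List ℕ} {e : C × L} (hp : t p = some e) :
    HasWinTree step win e.2 := by
  refine .of_simulation hwin ht.none_of_none htw (fun p y => ∃ c, t p = some (c, y)) ?_ ?_ p e.2
    ⟨e.1, hp⟩
  · rintro p y ⟨c, h⟩
    simp [h]
  · rintro p y ⟨c, h⟩
    obtain ⟨cs, hcs, hch⟩ := ht.children _ _ _ h
    refine ⟨cs, hcs, fun e he => .inr ?_⟩
    obtain ⟨k, hk⟩ := List.mem_iff_getElem?.1 he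
    exact ⟨k, by rw [hch, hk]; rfl, e.1, (hch k).trans hk⟩

/-- Grafting winning trees under a root, or removing the root, changes finitely many colours of each
branch. This includes the colours of the children, which are reset to `⊥` when they become roots. -/
theorem hasWinTree_iff {step : L → List (C × L) → Prop} {win : (ℕ → C) → Prop}
    (hwin : TailInvariant win) (x : L) :
    HasWinTree step win x ↔ ∃ cs, step x cs ∧ ∀ e ∈ cs, HasWinTree step win e.2 := by
  constructor
  · rintro ⟨t, ht, htw⟩
    obtain ⟨cs, hcs, hch⟩ := ht.children _ _ _ ht.root_eq
    refine ⟨cs, hcs, fun e he => ?_⟩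
    obtain ⟨k, hk⟩ := List.mem_iff_getElem?.1 he
    exact .of_subtree hwin ht htw ((hch k).trans hk)
  · rintro ⟨cs, hcs, hch⟩
    -- The guiding tree is a single node, so each child leaves it at once for its own winning tree.
    refine .of_simulation (t := fun p => if p = [] then some ((⊥ : C), x) else none) hwin ?_ ?_
      (fun p y => p = [] ∧ y = x) ?_ ?_ [] x ⟨rfl, rfl⟩
    · intro p k _
      simp
    · intro f hf
      exact absurd (if_neg (by simp [prefixAt])) (hf 1)
    · rintro p y ⟨rfl, rfl⟩
      simp
    · rintro p y ⟨rfl, rfl⟩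
      exact ⟨cs, hcs, fun e he => .inl (hch e he)⟩

theorem colourAt_of_eq_some {t : List ℕ → Option (C × L)} {p : List ℕ} {e : C × L}
    (h : t p = some e) : colourAt t p = e.1 := by
  simp [colourAt, h]

theorem pathColour_nil (t : List ℕ → Option (C × L)) : pathColour t [] = colourAt t [] := by
  simp [pathColour]

theorem pathColour_append (t : List ℕ → Option (C × L)) (p : List ℕ) (k : ℕ) :
    pathColour t (p ++ [k]) = max (pathColour t p) (colourAt t (p ++ [k])) := by
  unfold pathColour
  rw [List.length_append, List.length_singleton, Finset.range_add_one, Finset.sup_insert,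
    max_comm, List.take_of_length_le (by simp)]
  congr 1
  refine Finset.sup_congr rfl fun i hi => ?_
  rw [List.take_append_of_le_length (by have := Finset.mem_range.1 hi; omega)]

end WinningTrees

/-! ### Run-trees with a bounded set of leaves -/

section Fixpoint

variable {C : Type} [LinearOrder C] [OrderBot C]

/-- Local condition on run-trees of `R` in which every node also carries the greatest colour on the
path to the root, and whose set of leaves is contained in `w`. -/
def boundedRunStep {X A : Obj.{u}} (R : Mor ((X.cbang C).tensor (A.cbang C)) A)
    (w : Finset (C × X.carrier)) (y : C × (X.carrier ⊕ A.carrier))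
    (cs : List (C × C × (X.carrier ⊕ A.carrier))) : Prop :=
  runStep R y.2 (cs.map (Prod.map id Prod.snd)) ∧ (∀ e ∈ cs, e.2.1 = max y.1 e.1) ∧
    ∀ x, y.2 = .inl x → (y.1, x) ∈ w

/-- The set of leaves is a global datum; carrying the path colour in the labels makes the bound by
`w` a local condition, suited to simulation. Induction on the address shows that the carried colour
is the true path colour. -/
theorem fixRel_of_boundedRunStep {win : (ℕ → C) → Prop} {X A : Obj.{u}}
    {R : Mor ((X.cbang C).tensor (A.cbang C)) A} {w : Finset (C × X.carrier)} {a : A.carrier}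
    (h : HasWinTree (boundedRunStep R w) win (⊥, .inr a)) : fixRel win R w a := by
  classical
  obtain ⟨t, ht, htw⟩ := h
  let t' : List ℕ → Option (C × (X.carrier ⊕ A.carrier)) :=
    fun p => (t p).map (Prod.map id Prod.snd)
  have hcol : ∀ p, colourAt t' p = colourAt t p := by
    intro p
    simp only [colourAt, t']
    cases t p <;> rfl
  have hpath : ∀ p e, t p = some e → pathColour t' p = e.2.1 := by
    intro p
    induction p using List.reverseRecOn with
    | nil =>
      intro e he
      obtain rfl := Option.some.inj (ht.root_eq.symm.trans he)
      rw [pathColour_nil, hcol, colourAt_of_eq_some he]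
    | append_singleton p k ih =>
      intro e he
      obtain ⟨⟨c, y⟩, hp⟩ := Option.ne_none_iff_exists'.1 fun h =>
        absurd (ht.none_of_none p k h) (by simp [he])
      obtain ⟨cs, hcs, hch⟩ := ht.children _ _ _ hp
      rw [pathColour_append, hcol, colourAt_of_eq_some he, ih _ hp]
      exact (hcs.2.1 e (List.mem_of_getElem? ((hch k).symm.trans he))).symm
  have hsub : leaves t' ⊆ w := by
    rintro ⟨c, x⟩ ⟨p, c', hp, hc⟩
    obtain ⟨⟨c₁, d, y⟩, he, hy⟩ := Option.map_eq_some_iff.1 hp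
    obtain ⟨cs, hcs, -⟩ := ht.children _ _ _ he
    obtain rfl : c = d := hc.trans (hpath p _ he)
    exact hcs.2.2 x (congrArg Prod.snd hy)
  have hfin : (leaves t').Finite := w.finite_toSet.subset hsub
  -- The bound gives only an inclusion of the leaves in `w`, while `fixRel` asks for equality. The
  -- tree witnesses the relation for its exact, hence finite, set of leaves, and downward closure
  -- enlarges this set to `w`.
  refine fixRel_closed win R (w := hfin.toFinset) (a := a) ⟨t', ⟨?_, ?_, ?_⟩, ?_, ?_⟩ ?_ (A.refl a)
  · simp [t', ht.root_eq]
  · intro p c y hp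
    obtain ⟨⟨c₁, y₁⟩, he, hy⟩ := Option.map_eq_some_iff.1 hp
    obtain rfl : y₁.2 = y := congrArg Prod.snd hy
    obtain ⟨cs, hcs, hch⟩ := ht.children _ _ _ he
    exact ⟨_, hcs.1, fun k => by simp [t', hch]⟩
  · intro p k hp
    simp [t', ht.none_of_none p k (Option.map_eq_none_iff.1 hp)]
  · intro f hf
    simp only [hcol]
    exact htw f fun n h => hf n (by simp [t', h])
  · intro e
    simp
  · intro e he
    exact ⟨e, hsub (hfin.mem_toFinset.1 he), Obj.refl _ _⟩

end Fixpoint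

end ColScott

/-! ### Contexts as finite sets; variables and abstraction -/

namespace ColScott

namespace APT

variable {Q : Type u} {Sig : Type v} {ar : Sig → ℕ} {𝒜 : APT Q ar}

theorem tailInvariant_winSeq : TailInvariant 𝒜.WinSeq := by
  intro s k
  have h : ∀ m : 𝒜.Col, (∃ᶠ n in Filter.atTop, s (n + k) = m) ↔
      ∃ᶠ n in Filter.atTop, s n = m := by
    intro m
    rw [← Filter.frequently_map (m := fun n => n + k) (P := fun n => s n = m),
      Filter.map_add_atTop_eq_nat]
  simp only [WinSeq, h]

theorem exists_eq_inj : ∀ {Γ : List Ty} (y : (𝒜.semCtx Γ).carrier),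
    ∃ (σ : Ty) (x : Var Γ σ) (a : (𝒜.sem σ).carrier), y = 𝒜.inj x a
  | [], y => PEmpty.elim y
  | _ :: _, .inr a => ⟨_, .zero, a, rfl⟩
  | _ :: _, .inl y => by
    obtain ⟨σ, x, a, rfl⟩ := exists_eq_inj y
    exact ⟨σ, .succ x, a, rfl⟩

open Classical in
/-- The disjoint union of finite sets of coloured elements. -/
noncomputable def disjSum {C X A : Type*} (s : Finset (C × X)) (u : Finset (C × A)) :
    Finset (C × (X ⊕ A)) :=
  s.image (fun e => (e.1, Sum.inl e.2)) ∪ u.image (fun e => (e.1, Sum.inr e.2))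

theorem mem_disjSum_inl {C X A : Type*} (s : Finset (C × X)) (u : Finset (C × A)) (c : C) (y : X) :
    (c, Sum.inl y) ∈ disjSum s u ↔ (c, y) ∈ s := by
  simp [disjSum]

theorem mem_disjSum_inr {C X A : Type*} (s : Finset (C × X)) (u : Finset (C × A)) (c : C) (a : A) :
    (c, Sum.inr a) ∈ disjSum s u ↔ (c, a) ∈ u := by
  simp [disjSum]

/-- The finite subset of `⟦σ₁⟧ & ⋯ & ⟦σₙ⟧` which corresponds to a tuple `(u₁, …, uₙ)`. -/
noncomputable def flat : {Γ : List Ty} → 𝒜.Env Γ → Finset (𝒜.Col × (𝒜.semCtx Γ).carrier)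
  | [], _ => ∅
  | _ :: _, ρ => disjSum (flat fun _ x => ρ _ (.succ x)) (ρ _ .zero)

theorem mem_flat_inl {Γ : List Ty} {σ : Ty} (ρ : 𝒜.Env (σ :: Γ)) (c : 𝒜.Col)
    (y : (𝒜.semCtx Γ).carrier) :
    ((c, Sum.inl y) : 𝒜.Col × ((𝒜.semCtx Γ).carrier ⊕ (𝒜.sem σ).carrier)) ∈ flat ρ ↔
      (c, y) ∈ flat (𝒜 := 𝒜) fun _ x => ρ _ (.succ x) :=
  mem_disjSum_inl _ _ c y

theorem mem_flat_inr {Γ : List Ty} {σ : Ty} (ρ : 𝒜.Env (σ :: Γ)) (c : 𝒜.Col)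
    (a : (𝒜.sem σ).carrier) :
    ((c, Sum.inr a) : 𝒜.Col × ((𝒜.semCtx Γ).carrier ⊕ (𝒜.sem σ).carrier)) ∈ flat ρ ↔
      (c, a) ∈ ρ σ .zero :=
  mem_disjSum_inr _ _ c a

theorem mem_flat_inj : ∀ {Γ : List Ty} {σ : Ty} (ρ : 𝒜.Env Γ) (x : Var Γ σ) (c : 𝒜.Col)
    (a : (𝒜.sem σ).carrier), (c, 𝒜.inj x a) ∈ flat ρ ↔ (c, a) ∈ ρ σ x
  | _, _, ρ, .zero, c, a => mem_flat_inr ρ c a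
  | _, _, ρ, .succ x, c, a => (mem_flat_inl ρ c _).trans (mem_flat_inj _ x c a)

/-- Every element of a product of contexts is an injection, so `flat ρ` is the greatest set related
to `ρ`. Composing with the Seely isomorphism is therefore evaluation at `flat ρ`. -/
theorem seelyCtx_rel_iff {Γ : List Ty} (ρ : 𝒜.Env Γ)
    (w : Finset (𝒜.Col × (𝒜.semCtx Γ).carrier)) :
    (𝒜.seelyCtx Γ).rel ρ w ↔ ((𝒜.semCtx Γ).cbang 𝒜.Col).le w (flat ρ) := by
  constructor
  · intro h e he
    obtain ⟨σ, x, a, ha, hle⟩ := h e he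
    exact ⟨_, (mem_flat_inj ρ x e.1 a).2 ha, rfl, hle⟩
  · rintro h e he
    obtain ⟨⟨c, y⟩, hy, hc, hle⟩ := h e he
    obtain ⟨σ, x, a, rfl⟩ := exists_eq_inj y
    obtain rfl : e.1 = c := hc
    exact ⟨σ, x, a, (mem_flat_inj ρ x _ a).1 hy, hle⟩

theorem interp_rel_iff {Γ : List Ty} {τ : Ty} (t : Tm ar Γ τ) (ρ : 𝒜.Env Γ)
    (α : (𝒜.sem τ).carrier) : (𝒜.interp t).rel ρ α ↔ (𝒜.semTm t).rel (flat ρ) α := by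
  constructor
  · rintro ⟨w, hw, h⟩
    exact (𝒜.semTm t).closed h ((seelyCtx_rel_iff ρ w).1 hw) (Obj.refl _ _)
  · intro h
    exact ⟨_, (seelyCtx_rel_iff ρ _).2 (Obj.refl _ _), h⟩

theorem semTm_var_rel_iff {Γ : List Ty} {σ : Ty} (x : Var Γ σ) (ρ : 𝒜.Env Γ)
    (α : (𝒜.sem σ).carrier) : (𝒜.semTm (.var x)).rel (flat ρ) α ↔
      ∃ α', (⊥, α') ∈ ρ σ x ∧ (𝒜.sem σ).le α α' := by
  constructor
  · rintro ⟨y, ⟨b, ⟨⟨c, y'⟩, hmem, hc, hle⟩, hb, hyb⟩, hproj⟩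
    obtain ⟨α', rfl, hα⟩ := (𝒜.proj x).closed hproj (Obj.trans _ hyb hle) (Obj.refl _ α)
    obtain rfl : c = ⊥ := hc.symm.trans hb
    exact ⟨α', (mem_flat_inj ρ x _ _).1 hmem, hα⟩
  · rintro ⟨α', hα', hle⟩
    exact ⟨𝒜.inj x α', ⟨(⊥, 𝒜.inj x α'), ⟨_, (mem_flat_inj ρ x _ _).2 hα', Obj.refl _ _⟩, rfl,
      Obj.refl _ _⟩, α', rfl, hle⟩

theorem seely_rel_iff {Γ : List Ty} {σ : Ty} (ρ : 𝒜.Env Γ)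
    (u : Finset (𝒜.Col × (𝒜.sem σ).carrier))
    (w : Finset (𝒜.Col × (𝒜.semCtx (σ :: Γ)).carrier)) :
    (Mor.seely 𝒜.Col (𝒜.semCtx Γ) (𝒜.sem σ)).rel (flat ρ, u) w ↔
      ((𝒜.semCtx (σ :: Γ)).cbang 𝒜.Col).le w (flat (ρ.cons u)) := by
  constructor
  · rintro ⟨h₁, h₂⟩ ⟨c, y | a⟩ he
    · obtain ⟨y', hy', hle⟩ := h₁ c y he
      exact ⟨(c, Sum.inl y'), (mem_flat_inl (ρ.cons u) c y').2 hy', rfl, .inl hle⟩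
    · obtain ⟨a', ha', hle⟩ := h₂ c a he
      exact ⟨(c, Sum.inr a'), (mem_flat_inr (ρ.cons u) c a').2 ha', rfl, .inr hle⟩
  · intro h
    constructor
    · intro c y hy
      obtain ⟨⟨c', y'⟩, hy', hc, hle⟩ := h _ hy
      obtain rfl : c = c' := hc
      cases hle with
      | inl hle => exact ⟨_, (mem_flat_inl (ρ.cons u) c _).1 hy', hle⟩
    · intro c a ha
      obtain ⟨⟨c', y'⟩, hy', hc, hle⟩ := h _ ha
      obtain rfl : c = c' := hc
      cases hle with
      | inr hle => exact ⟨_, (mem_flat_inr (ρ.cons u) c _).1 hy', hle⟩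

theorem semTm_lam_rel_iff {Γ : List Ty} {σ τ : Ty} (M : Tm ar (σ :: Γ) τ) (ρ : 𝒜.Env Γ)
    (α : (𝒜.sem (.arr σ τ)).carrier) : (𝒜.semTm (.lam M)).rel (flat ρ) α ↔
      (𝒜.semTm M).rel (flat (ρ.cons α.1)) α.2 := by
  constructor
  · rintro ⟨w, hw, h⟩
    exact (𝒜.semTm M).closed h ((seely_rel_iff ρ _ w).1 hw) (Obj.refl _ _)
  · intro h
    exact ⟨_, (seely_rel_iff ρ _ _).2 (Obj.refl _ _), h⟩

end APT

/-! ### Comultiplication, residual contexts and application -/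

open Classical in
-- The three stages of the comultiplication collapse: a set `w'` used at colour `c` costs exactly
-- its recolouring by `c`.
theorem Mor.dig_comp_cbang_rel_iff {C : Type} [LinearOrder C] [OrderBot C] {A B : Obj.{u}}
    (R : Mor (A.cbang C) B) (w : Finset (C × A.carrier)) (v : Finset (C × B.carrier)) :
    ((Mor.dig C A).comp (Mor.cbang C R)).rel w v ↔ ∀ e ∈ v, ∃ w' : Finset (C × A.carrier),
      (A.cbang C).le (w'.image fun d => (max e.1 d.1, d.2)) w ∧ R.rel w' e.2 := by
  constructor
  · rintro ⟨U, ⟨V, ⟨W, hW, hWV⟩, hVU⟩, hUv⟩ e he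
    obtain ⟨⟨c, w'⟩, hw', hc, hR⟩ := hUv e he
    obtain rfl : c = e.1 := hc
    refine ⟨w', ?_, hR⟩
    intro d hd
    obtain ⟨d, hdw, rfl⟩ := Finset.mem_image.1 hd
    obtain ⟨V₁, hV₁, h₁⟩ := hVU _ hw'
    obtain ⟨⟨c₂, d₂⟩, hd₂, hc₂, hc₂', hle₂⟩ := h₁ d hdw
    obtain ⟨W₁, hW₁, h₃⟩ := hWV V₁ hV₁
    obtain ⟨⟨c₃, a₃⟩, hd₃, hc₃, hle₃⟩ := h₃ _ hd₂
    obtain ⟨⟨c₄, a₄⟩, hd₄, hc₄, hle₄⟩ := hW W₁ hW₁ _ hd₃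
    refine ⟨_, hd₄, ?_, A.trans hle₂ (A.trans hle₃ hle₄)⟩
    dsimp only at hc₂ hc₂' hc₃ hc₄ ⊢
    rw [← hc₄, hc₃, ← hc₂', ← hc₂]
  · intro h
    choose! f hf hR using h
    -- Undoing the stages from last to first: `U` tags each chosen set with its colour, `V` moves
    -- the tag onto the elements, and `W` absorbs it by `max`.
    let U : Finset (C × Finset (C × A.carrier)) := v.image fun e => (e.1, f e)
    let V : Finset (Finset (C × C × A.carrier)) :=
      v.image fun e => (f e).image fun d => (e.1, d)
    let W : Finset (Finset (C × A.carrier)) :=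
      v.image fun e => (f e).image fun d => (max e.1 d.1, d.2)
    refine ⟨U, ⟨V, ⟨W, ?_, ?_⟩, ?_⟩, ?_⟩
    · intro w' hw'
      obtain ⟨e, he, rfl⟩ := Finset.mem_image.1 hw'
      exact hf e he
    · intro V₁ hV₁
      obtain ⟨e, he, rfl⟩ := Finset.mem_image.1 hV₁
      refine ⟨_, Finset.mem_image_of_mem _ he, ?_⟩
      intro d hd
      obtain ⟨d, hdw, rfl⟩ := Finset.mem_image.1 hd
      exact ⟨_, Finset.mem_image_of_mem _ hdw, rfl, A.refl _⟩
    · intro U₁ hU₁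
      obtain ⟨e, he, rfl⟩ := Finset.mem_image.1 hU₁
      refine ⟨_, Finset.mem_image_of_mem _ he, ?_⟩
      intro d hd
      exact ⟨(e.1, d), Finset.mem_image_of_mem _ hd, rfl, Obj.refl _ _⟩
    · intro e he
      exact ⟨_, Finset.mem_image_of_mem _ he, rfl, hR e he⟩

namespace APT

variable {Q : Type u} {Sig : Type v} {ar : Sig → ℕ} {𝒜 : APT Q ar}

theorem mem_recolour {A : Type u} (c : 𝒜.Col) (u : Finset (𝒜.Col × A)) (d : 𝒜.Col) (a : A) :
    (d, a) ∈ 𝒜.recolour c u ↔ ∃ d', max c d' = d ∧ (d', a) ∈ u := by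
  simp only [recolour, Finset.mem_image, Prod.exists, Prod.mk.injEq]
  grind

theorem mem_join {Γ : List Ty} (ρ₀ : 𝒜.Env Γ) {n : ℕ} (c : Fin n → 𝒜.Col)
    (ρ : Fin n → 𝒜.Env Γ) {σ : Ty} (x : Var Γ σ) (d : 𝒜.Col) (a : (𝒜.sem σ).carrier) :
    (d, a) ∈ ρ₀.join c ρ σ x ↔
      (d, a) ∈ ρ₀ σ x ∨ ∃ i d', max (c i) d' = d ∧ (d', a) ∈ ρ i σ x := by
  simp [Env.join, mem_recolour]

/-- Finiteness of `Q` enters here: an element of colour `c` in `ρ` contributes all colours `d ≤ c`,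
so the residual is finite because there are finitely many colours. -/
theorem exists_residual [Finite Q] {Γ : List Ty} (c : 𝒜.Col) (ρ : 𝒜.Env Γ) :
    ∃ ρ' : 𝒜.Env Γ, ∀ σ x d a, (d, a) ∈ ρ' σ x ↔ (max c d, a) ∈ ρ σ x := by
  have : Finite 𝒜.Col := inferInstanceAs (Finite (Option (Set.range 𝒜.Ω)))
  have h : ∀ (σ : Ty) (x : Var Γ σ),
      {e : 𝒜.Col × (𝒜.sem σ).carrier | (max c e.1, e.2) ∈ ρ σ x}.Finite := by
    intro σ x
    refine (Set.finite_univ.prod ((ρ σ x).finite_toSet.image Prod.snd)).subset ?_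
    intro e he
    exact ⟨trivial, _, he, rfl⟩
  exact ⟨fun σ x => (h σ x).toFinset, fun σ x d a => by simp⟩

/-- The context `Γ'` such that `□_c Γ'` is the part of `Γ` of colours at least `c`. -/
noncomputable def Env.residual [Finite Q] {Γ : List Ty} (c : 𝒜.Col) (ρ : 𝒜.Env Γ) : 𝒜.Env Γ :=
  (exists_residual c ρ).choose

theorem mem_residual [Finite Q] {Γ : List Ty} (c : 𝒜.Col) (ρ : 𝒜.Env Γ) {σ : Ty} (x : Var Γ σ)
    (d : 𝒜.Col) (a : (𝒜.sem σ).carrier) : (d, a) ∈ ρ.residual c σ x ↔ (max c d, a) ∈ ρ σ x :=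
  (exists_residual c ρ).choose_spec σ x d a

theorem Env.residual_bot [Finite Q] {Γ : List Ty} (ρ : 𝒜.Env Γ) : ρ.residual ⊥ = ρ := by
  funext σ x
  ext ⟨d, a⟩
  rw [mem_residual, max_bot_left]

theorem Env.residual_residual [Finite Q] {Γ : List Ty} (c d : 𝒜.Col) (ρ : 𝒜.Env Γ) :
    (ρ.residual c).residual d = ρ.residual (max c d) := by
  funext σ x
  ext ⟨e, a⟩
  rw [mem_residual, mem_residual, mem_residual, max_assoc]

/-- Recolouring a residual by its colour lands back in `ρ`. Hence `ρ` itself can serve as `Γ₀` and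
its residuals as the other contexts, whatever the colours. -/
theorem Env.join_residual [Finite Q] {Γ : List Ty} (ρ : 𝒜.Env Γ) {n : ℕ} (c : Fin n → 𝒜.Col) :
    ρ.join c (fun i => ρ.residual (c i)) = ρ := by
  funext σ x
  ext ⟨d, a⟩
  rw [mem_join]
  constructor
  · rintro (h | ⟨i, d', rfl, h⟩)
    · exact h
    · exact (mem_residual _ _ _ _ _).1 h
  · exact .inl

theorem arrow_toList {σ τ : Ty} (v : Finset (𝒜.Col × (𝒜.sem σ).carrier)) (α : (𝒜.sem τ).carrier) :
    𝒜.arrow (fun i => (v.toList.get i).1) (fun i => (v.toList.get i).2) α = (v, α) := by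
  classical
  refine Prod.ext ?_ rfl
  ext e
  simp only [arrow, Finset.mem_image, Finset.mem_univ, true_and]
  rw [← Finset.mem_toList, List.mem_iff_get]

theorem semTm_app_rel_iff {Γ : List Ty} {σ τ : Ty} (M : Tm ar Γ (.arr σ τ)) (N : Tm ar Γ σ)
    (w : Finset (𝒜.Col × (𝒜.semCtx Γ).carrier)) (α : (𝒜.sem τ).carrier) :
    (𝒜.semTm (.app M N)).rel w α ↔ ∃ v : Finset (𝒜.Col × (𝒜.sem σ).carrier),
      (𝒜.semTm M).rel w (v, α) ∧ ∀ e ∈ v, ∃ w' : Finset (𝒜.Col × (𝒜.semCtx Γ).carrier),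
        ((𝒜.semCtx Γ).cbang 𝒜.Col).le (𝒜.recolour e.1 w') w ∧ (𝒜.semTm N).rel w' e.2 := by
  constructor
  · rintro ⟨⟨⟨u, α'⟩, v⟩, ⟨⟨w₁, w₂⟩, ⟨hw₁, hw₂⟩, hM, hN⟩, huv, hα⟩
    have hM : (𝒜.semTm M).rel w₁ (u, α') := hM
    refine ⟨v, (𝒜.semTm M).closed hM hw₁ ⟨huv, hα⟩, fun e he => ?_⟩
    obtain ⟨w', hw', h⟩ := (Mor.dig_comp_cbang_rel_iff _ _ _).1 hN e he
    exact ⟨w', Obj.trans _ hw' hw₂, h⟩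
  · rintro ⟨v, hM, hN⟩
    exact ⟨((v, α), v), ⟨(w, w), ⟨Obj.refl _ _, Obj.refl _ _⟩, hM,
      (Mor.dig_comp_cbang_rel_iff _ _ _).2 hN⟩, Obj.refl _ _, Obj.refl _ _⟩

theorem flat_le_flat {Γ : List Ty} {ρ ρ' : 𝒜.Env Γ}
    (h : ∀ σ (x : Var Γ σ) d a, (d, a) ∈ ρ σ x → (d, a) ∈ ρ' σ x) :
    ((𝒜.semCtx Γ).cbang 𝒜.Col).le (flat ρ) (flat ρ') := by
  rintro ⟨c, y⟩ hy
  obtain ⟨σ, x, a, rfl⟩ := exists_eq_inj y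
  exact ⟨_, (mem_flat_inj _ _ _ _).2 (h _ _ _ _ ((mem_flat_inj _ _ _ _).1 hy)), Obj.refl _ _⟩

theorem recolour_flat_le {Γ : List Ty} {ρ ρ' : 𝒜.Env Γ} {c : 𝒜.Col}
    (h : ∀ σ (x : Var Γ σ) d a, (d, a) ∈ ρ σ x → (max c d, a) ∈ ρ' σ x) :
    ((𝒜.semCtx Γ).cbang 𝒜.Col).le (𝒜.recolour c (flat ρ)) (flat ρ') := by
  rintro ⟨d, y⟩ hy
  obtain ⟨d, rfl, hd⟩ := (mem_recolour _ _ _ _).1 hy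
  obtain ⟨σ, x, a, rfl⟩ := exists_eq_inj y
  exact ⟨_, (mem_flat_inj _ _ _ _).2 (h _ _ _ _ ((mem_flat_inj _ _ _ _).1 hd)), Obj.refl _ _⟩

theorem mem_flat_residual [Finite Q] {Γ : List Ty} (c : 𝒜.Col) (ρ : 𝒜.Env Γ) (d : 𝒜.Col)
    (y : (𝒜.semCtx Γ).carrier) : (d, y) ∈ flat (ρ.residual c) ↔ (max c d, y) ∈ flat ρ := by
  obtain ⟨σ, x, a, rfl⟩ := exists_eq_inj y
  rw [mem_flat_inj, mem_flat_inj, mem_residual]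

/-- The residual behaves as a right adjoint of recolouring, hence is the most generous context for a
premise of colour `c`. -/
theorem le_flat_residual [Finite Q] {Γ : List Ty} {c : 𝒜.Col} {ρ : 𝒜.Env Γ}
    {w : Finset (𝒜.Col × (𝒜.semCtx Γ).carrier)}
    (h : ((𝒜.semCtx Γ).cbang 𝒜.Col).le (𝒜.recolour c w) (flat ρ)) :
    ((𝒜.semCtx Γ).cbang 𝒜.Col).le w (flat (ρ.residual c)) := by
  rintro ⟨d, y⟩ hy
  obtain ⟨⟨c', y'⟩, hy', hc, hle⟩ := h (max c d, y) ((mem_recolour _ _ _ _).2 ⟨d, rfl, hy⟩)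
  obtain rfl : max c d = c' := hc
  exact ⟨(d, y'), (mem_flat_residual _ _ _ _).2 hy', rfl, hle⟩

theorem hasWinningDerivation_app_iff [Finite Q] {Γ : List Ty} {σ τ : Ty}
    {M : Tm ar Γ (.arr σ τ)} {N : Tm ar Γ σ}
    (hM : ∀ ρ α, 𝒜.HasWinningDerivation ⟨Γ, _, M, ρ, α⟩ ↔ (𝒜.semTm M).rel (flat ρ) α)
    (hN : ∀ ρ α, 𝒜.HasWinningDerivation ⟨Γ, _, N, ρ, α⟩ ↔ (𝒜.semTm N).rel (flat ρ) α)
    (ρ : 𝒜.Env Γ) (α : (𝒜.sem τ).carrier) :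
    𝒜.HasWinningDerivation ⟨Γ, τ, .app M N, ρ, α⟩ ↔ (𝒜.semTm (.app M N)).rel (flat ρ) α := by
  classical
  rw [semTm_app_rel_iff]
  refine (hasWinTree_iff tailInvariant_winSeq _).trans ?_
  constructor
  · rintro ⟨_, ⟨n, c, β, ρ₀, ρ', hρ, rfl⟩, hps⟩
    have hρ : ρ = ρ₀.join c ρ' := hρ
    refine ⟨_, (𝒜.semTm M).closed ((hM _ _).1 (hps _ List.mem_cons_self))
      (flat_le_flat fun σ x d a h => ?_) (Obj.refl _ _), ?_⟩
    · rw [hρ, mem_join]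
      exact .inl h
    · intro e he
      obtain ⟨i, -, rfl⟩ := Finset.mem_image.1 he
      refine ⟨flat (ρ' i), recolour_flat_le fun σ x d a h => ?_,
        (hN _ _).1 (hps _ (List.mem_cons_of_mem _ (List.mem_ofFn.2 ⟨i, rfl⟩)))⟩
      rw [hρ, mem_join]
      exact .inr ⟨i, d, rfl, h⟩
  · rintro ⟨v, hv, h⟩
    refine ⟨_, ⟨_, fun i => (v.toList.get i).1, fun i => (v.toList.get i).2, ρ,
      fun i => ρ.residual (v.toList.get i).1, (Env.join_residual ρ _).symm, rfl⟩, fun e he => ?_⟩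
    rcases List.mem_cons.1 he with rfl | he
    · refine (hM _ _).2 ?_
      dsimp only
      rw [arrow_toList]
      exact hv
    · obtain ⟨i, rfl⟩ := List.mem_ofFn.1 he
      obtain ⟨w', hw', hr⟩ := h (v.toList.get i) (Finset.mem_toList.1 (List.get_mem _ _))
      exact (hN _ _).2 ((𝒜.semTm N).closed hr (le_flat_residual hw') (Obj.refl _ _))

/-! ### Fixpoints: derivations and run-trees -/

theorem semTm_fix_rel_of_hasWinningDerivation {Γ : List Ty} {σ : Ty} {M : Tm ar Γ (.arr σ σ)}
    (hM : ∀ ρ α, 𝒜.HasWinningDerivation ⟨Γ, _, M, ρ, α⟩ → (𝒜.semTm M).rel (flat ρ) α)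
    {ρ : 𝒜.Env Γ} {α : (𝒜.sem σ).carrier}
    (h : 𝒜.HasWinningDerivation ⟨Γ, σ, .fix M, ρ, α⟩) :
    (𝒜.semTm (.fix M)).rel (flat ρ) α := by
  classical
  obtain ⟨D, hD, hDw⟩ := h
  refine fixRel_of_boundedRunStep (.of_simulation tailInvariant_winSeq hD.none_of_none hDw
    -- Simulation along the spine of `D`. The invariant is that the context of the current sequent,
    -- recoloured by the path colour `y.1`, is contained in `ρ`.
    (fun p y => ∃ c ρ' b, D p = some (c, ⟨Γ, σ, .fix M, ρ', b⟩) ∧ y.2 = .inr b ∧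
      ∀ τ (x : Var Γ τ) d a, (d, a) ∈ ρ' τ x → (max y.1 d, a) ∈ ρ τ x) ?_ ?_ [] _
    ⟨_, _, _, hD.root_eq, rfl, fun τ x d a h => by rwa [max_bot_left]⟩)
  · rintro p y ⟨c, ρ', b, h, -⟩
    simp [h]
  · rintro p ⟨d, _⟩ ⟨c, ρ', b, hp, rfl, hρ'⟩
    obtain ⟨_, ⟨n, c, β, ρ₀, ρ₁, hρ₁, rfl⟩, hch⟩ := hD.children _ _ _ hp
    have hρ₁ : ρ' = ρ₀.join c ρ₁ := hρ₁
    have hrel := hM _ _ (HasWinTree.of_subtree tailInvariant_winSeq hD hDw (hch 0))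
    -- The context `ρ₀` used by the premise on `M` supplies the children in `X`; the premises on `Y
    -- M` supply those in `A`, with their colours.
    refine ⟨(flat ρ₀).toList.map (fun e => (e.1, max d e.1, .inl e.2)) ++
      List.ofFn (fun i => (c i, max d (c i), .inr (β i))),
      ⟨⟨flat ρ₀, Finset.univ.image fun i => (c i, β i), ?_, ?_, hrel⟩, ?_, ?_⟩, ?_⟩
    · intro e x
      simp
    · intro e a
      simp [List.mem_ofFn]
    · intro e he
      rcases List.mem_append.1 he with he | he
      · obtain ⟨e, -, rfl⟩ := List.mem_map.1 he
        rfl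
      · obtain ⟨i, rfl⟩ := List.mem_ofFn.1 he
        rfl
    · intro x hx
      cases hx
    · intro e he
      rcases List.mem_append.1 he with he | he
      · obtain ⟨⟨e, y⟩, hy, rfl⟩ := List.mem_map.1 he
        refine .inl ((hasWinTree_iff tailInvariant_winSeq _).2 ⟨[], ⟨rfl, by simp, ?_⟩, by simp⟩)
        rintro _ ⟨rfl⟩
        obtain ⟨τ, x, a, rfl⟩ := exists_eq_inj y
        rw [Finset.mem_toList, mem_flat_inj] at hy
        refine (mem_flat_inj _ _ _ _).2 (hρ' _ _ _ _ ?_)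
        rw [hρ₁, mem_join]
        exact .inl hy
      · obtain ⟨i, rfl⟩ := List.mem_ofFn.1 he
        -- Child `0` is the premise on `M`, hence the shift.
        have hi := hch (i + 1)
        rw [List.getElem?_cons_succ, List.getElem?_ofFn, dif_pos i.2] at hi
        refine .inr ⟨i + 1, by rw [hi]; rfl, _, _, _, hi, rfl, ?_⟩
        intro τ x e a he
        dsimp only
        rw [max_assoc]
        refine hρ' _ _ _ _ ?_
        rw [hρ₁, mem_join]
        exact .inr ⟨i, e, rfl, he⟩

theorem hasWinningDerivation_fix_of_semTm_rel [Finite Q] {Γ : List Ty} {σ : Ty}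
    {M : Tm ar Γ (.arr σ σ)}
    (hM : ∀ ρ α, (𝒜.semTm M).rel (flat ρ) α → 𝒜.HasWinningDerivation ⟨Γ, _, M, ρ, α⟩)
    {ρ : 𝒜.Env Γ} {α : (𝒜.sem σ).carrier} (h : (𝒜.semTm (.fix M)).rel (flat ρ) α) :
    𝒜.HasWinningDerivation ⟨Γ, σ, .fix M, ρ, α⟩ := by
  obtain ⟨t, ht, htw, hleaves⟩ := h
  refine HasWinTree.of_simulation tailInvariant_winSeq ht.none_of_none htw
    -- Each node receives the residual of `ρ` by its path colour; `Env.residual_residual` makes this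
    -- choice compatible with passing to a child.
    (fun p s => ∃ c b, t p = some (c, .inr b) ∧
      s = ⟨Γ, σ, .fix M, ρ.residual (pathColour t p), b⟩) ?_ ?_ [] _
    ⟨_, _, ht.root_eq, ?_⟩
  · rintro p s ⟨c, b, h, -⟩
    simp [h]
  · rintro p _ ⟨c, b, hp, rfl⟩
    obtain ⟨cs, ⟨w, v, hw, hv, hR⟩, hch⟩ := ht.children _ _ _ hp
    refine ⟨_, ⟨_, fun i => (v.toList.get i).1, fun i => (v.toList.get i).2, _,
      fun i => Env.residual (v.toList.get i).1 _, (Env.join_residual _ _).symm, rfl⟩,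
      fun e he => ?_⟩
    rcases List.mem_cons.1 he with rfl | he
    · refine .inl (hM _ _ ?_)
      rw [arrow_toList]
      refine (𝒜.semTm M).closed (show (𝒜.semTm M).rel w (v, b) from hR) ?_ (Obj.refl _ _)
      -- A child in `X` of colour `d` is a leaf whose path colour is the maximum of `d` and the
      -- colour at `p`. It therefore lies in `ρ` at that maximum, and in the residual at `d`.
      rintro ⟨d, y⟩ hy
      refine ⟨(d, y), (mem_flat_residual _ _ _ _).2 ((hleaves _).2 ?_), Obj.refl _ _⟩
      obtain ⟨k, hk⟩ := List.mem_iff_getElem?.1 ((hw _ _).1 hy)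
      have hk := (hch k).trans hk
      exact ⟨p ++ [k], d, hk, by rw [pathColour_append, colourAt_of_eq_some hk]⟩
    · obtain ⟨i, rfl⟩ := List.mem_ofFn.1 he
      obtain ⟨k, hk⟩ := List.mem_iff_getElem?.1
        ((hv _ _).1 (Finset.mem_toList.1 (List.get_mem v.toList i)))
      have hk := (hch k).trans hk
      refine .inr ⟨k, by rw [hk]; rfl, _, _, hk, ?_⟩
      dsimp only
      rw [pathColour_append, colourAt_of_eq_some hk, Env.residual_residual]
  · rw [pathColour_nil, colourAt_of_eq_some ht.root_eq, Env.residual_bot]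

/-! ### Induction on terms -/

theorem hasWinningDerivation_iff_semTm [Finite Q] {Γ : List Ty} {τ : Ty} (t : Tm ar Γ τ)
    (ρ : 𝒜.Env Γ) (α : (𝒜.sem τ).carrier) :
    𝒜.HasWinningDerivation ⟨Γ, τ, t, ρ, α⟩ ↔ (𝒜.semTm t).rel (flat ρ) α := by
  induction t with
  | var x =>
    rw [semTm_var_rel_iff]
    refine (hasWinTree_iff tailInvariant_winSeq _).trans ⟨?_, fun h => ⟨[], ⟨rfl, h⟩, by simp⟩⟩
    rintro ⟨_, ⟨-, h⟩, -⟩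
    exact h
  | con a =>
    refine (hasWinTree_iff tailInvariant_winSeq _).trans ⟨?_, fun h => ⟨[], ⟨rfl, h⟩, by simp⟩⟩
    rintro ⟨_, ⟨-, h⟩, -⟩
    exact h
  | lam M ih =>
    rw [semTm_lam_rel_iff, ← ih]
    refine (hasWinTree_iff tailInvariant_winSeq _).trans ⟨?_, fun h => ⟨_, rfl, ?_⟩⟩
    · rintro ⟨_, rfl, h⟩
      exact h _ (List.mem_singleton.2 rfl)
    · intro e he
      obtain rfl := List.mem_singleton.1 he
      exact h
  | app M N ihM ihN => exact hasWinningDerivation_app_iff ihM ihN ρ α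
  | fix M ih =>
    exact ⟨semTm_fix_rel_of_hasWinningDerivation fun ρ α => (ih ρ α).1,
      hasWinningDerivation_fix_of_semTm_rel fun ρ α => (ih ρ α).2⟩

end APT

end ColScott

theorem mainTheorem4 {Q : Type u} [Finite Q] {Sig : Type v} {ar : Sig → ℕ}
    (𝒜 : ColScott.APT Q ar) {Γ : List ColScott.Ty} {τ : ColScott.Ty} (t : ColScott.Tm ar Γ τ)
    (ρ : 𝒜.Env Γ) (α : (𝒜.sem τ).carrier) :
    𝒜.HasWinningDerivation ⟨Γ, τ, t, ρ, α⟩ ↔ (𝒜.interp t).rel ρ α :=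
  (ColScott.APT.hasWinningDerivation_iff_semTm t ρ α).trans
    (ColScott.APT.interp_rel_iff t ρ α).symm
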